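/- Let $n\ge 3$ be odd, let $B=\{x\in\mathbb R^n:|x|<1\}$, and let $f$ be a real- or complex-valued $C^\infty$ function on $\mathbb R^n$ whose (closed) support is contained in the open ball $B$. Let $S^{n-1}$ be the unit sphere in $\mathbb R^n$, $d\theta$ and $d\sigma$ its surface measure, $\sigma_{n-1}=2\pi^{n/2}/\Gamma(n/2)$ its area, and let $$\varphi_\theta(t)=(Mf)(\theta,t)=\frac1{\sigma_{n-1}}\int_{S^{n-1}}f(\theta-t\sigma)\,d\sigma,\qquad \theta\in S^{n-1},\ t>0,$$ be the spherical means of $f$ with centers on $S^{n-1}$. Put $$D=\frac1{2t}\frac{d}{dt},\qquad \Delta=\sum_{k=1}^n\frac{\partial^2}{\partial x_k^2},\qquad c_n=\frac{(-1)^{(n-1)/2}}{4\pi^{n/2-1}\Gamma(n/2)}.$$ Then each $\varphi_\theta$ is $C^\infty$ on $(0,\infty)$; for every $x\in B$ the function $\theta\mapsto \bigl[D^{n-3}\bigl(t^{n-2}\varphi_\theta(t)\bigr)\bigr]_{t=|x-\theta|}$ is integrable on $S^{n-1}$; its integral over $S^{n-1}$ is a $C^2$ function of $x\in B$; and $$f(x)=c_n\,\Delta\int_{S^{n-1}}\Bigl[D^{n-3}\bigl(t^{n-2}\varphi_\theta(t)\bigr)\Bigr]_{t=|x-\theta|}\,d\theta\qquad\text{for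 every }x\in B.$$ -/

import Mathlib

open Set Metric MeasureTheory
open scoped ContDiff

noncomputable section

/-- The area `σ_{n-1} = 2 π^{n/2} / Γ(n/2)` of the unit sphere of `ℝⁿ`. -/
def sphereArea (n : ℕ) : ℝ :=
  2 * Real.pi ^ ((n : ℝ) / 2) / Real.Gamma ((n : ℝ) / 2)

/-- The usual (unnormalized) surface measure on the unit sphere of `ℝⁿ`. -/
def sphereMeasure (n : ℕ) : Measure (sphere (0 : EuclideanSpace ℝ (Fin n)) 1) :=
  (volume : Measure (EuclideanSpace ℝ (Fin n))).toSphere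

/-- The spherical mean `(Mf)(θ, t) = σ_{n-1}⁻¹ ∫_{S^{n-1}} f(θ - t σ) dσ`. -/
def sphericalMean {𝕜 : Type*} [RCLike 𝕜] {n : ℕ} (f : EuclideanSpace ℝ (Fin n) → 𝕜)
    (θ : EuclideanSpace ℝ (Fin n)) (t : ℝ) : 𝕜 :=
  (1 / sphereArea n) • ∫ σ : sphere (0 : EuclideanSpace ℝ (Fin n)) 1,
    f (θ - t • (σ : EuclideanSpace ℝ (Fin n))) ∂(sphereMeasure n)

/-- The differential operator `D = (1 / 2t) d/dt`, used for `t > 0` only. -/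
def opD {𝕜 : Type*} [RCLike 𝕜] (g : ℝ → 𝕜) (t : ℝ) : 𝕜 :=
  (1 / (2 * t)) • deriv g t

/-- The filtered data `t ↦ D^{n-3} [t^{n-2} (Mf)(θ, t)]`, for `n ≥ 3`. -/
def filteredMean {𝕜 : Type*} [RCLike 𝕜] {n : ℕ} (f : EuclideanSpace ℝ (Fin n) → 𝕜)
    (θ : EuclideanSpace ℝ (Fin n)) : ℝ → 𝕜 :=
  opD^[n - 3] (fun t : ℝ => t ^ (n - 2) • sphericalMean f θ t)

/-- `x ↦ ∫_{S^{n-1}} [D^{n-3} t^{n-2} (Mf)(θ, t)]_{t = |x - θ|} dθ`. -/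
def backProjection {𝕜 : Type*} [RCLike 𝕜] {n : ℕ} (f : EuclideanSpace ℝ (Fin n) → 𝕜)
    (x : EuclideanSpace ℝ (Fin n)) : 𝕜 :=
  ∫ θ : sphere (0 : EuclideanSpace ℝ (Fin n)) 1,
    filteredMean f θ ‖x - (θ : EuclideanSpace ℝ (Fin n))‖ ∂(sphereMeasure n)

/-- `c_n = (-1)^{(n-1)/2} / (4 π^{n/2 - 1} Γ(n/2))`, for odd `n`. -/
def inversionConst (n : ℕ) : ℝ :=
  (-1) ^ ((n - 1) / 2) / (4 * Real.pi ^ ((n : ℝ) / 2 - 1) * Real.Gamma ((n : ℝ) / 2))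

end

/-! The back-projection turns out to be a constant multiple of the Newtonian potential of `f` on
`B`; its Laplacian is therefore a multiple of `f`, and the constant makes the product 1.

To see this, smear the evaluation at `t = |x - θ|` with a bump of width `η` in the variable `s =
t²`. There `D` is `d/ds`, so integration by parts moves `D^{n-3}` onto the bump `ψ`
(`integral_iteratedDeriv_comp_sq_smul_iterate_opD`), and `t^{n-2} · 2t dt` is twice the polar
density, so an integral of `ψ^{(n-3)}(|θ-y|² - |x-θ|²) f(y)` over `y` appears
(`integral_smul_filteredMean_sqrt`).

After exchanging the integrals, the kernel is the integral over `θ` of `ψ^{(n-3)}`. Its argument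
`|y|² - |x|² + 2(x-y)·θ` is affine in `θ`. For `n = 2m+3`, such an integral has the one-dimensional
weight `(1-s²)^m`, a polynomial of degree `n-3`; integrating by parts `n-3` times leaves a constant
times `|2(x-y)|^{-(n-2)} ∫ ψ` (`integral_sphere_iteratedDeriv_comp_inner`). This is exact once the
support of the bump fits in the interval swept by `θ`, which for `x, y ∈ B`, `x ≠ y`, holds for
small `η`.

Dominated convergence as `η → 0` gives the potential (`backProjection_eq_newtonianPotential`), and
`laplacian_newtonianPotential` concludes. -/

/-! ### Smoothness of integrals over a compact parameter space. -/

section ParametricIntegrals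

/-- Differentiate under the integral; the derivative is an integral of the same kind with values in
`P →L[ℝ] G`, so the induction quantifies over `G`. Taking `P` in `Type` keeps this space in the
universe of `G`. -/
theorem contDiff_integral_compact {P : Type} [NormedAddCommGroup P] [NormedSpace ℝ P]
    [FiniteDimensional ℝ P] {E : Type*} [NormedAddCommGroup E] [NormedSpace ℝ E]
    {K : Type*} [TopologicalSpace K] [CompactSpace K] [MeasurableSpace K]
    [OpensMeasurableSpace K] [SecondCountableTopology K] (μ : Measure K) [IsFiniteMeasure μ]
    {ι : K → E} (hι : Continuous ι) (k : ℕ) :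
    ∀ {G : Type*} [NormedAddCommGroup G] [NormedSpace ℝ G] {F : P × E → G},
      ContDiff ℝ ∞ F → ContDiff ℝ k (fun p => ∫ s, F (p, ι s) ∂μ) := by
  have cont : ∀ {G : Type _} [NormedAddCommGroup G] [NormedSpace ℝ G] {F : P × E → G},
      Continuous F → Continuous (fun p => ∫ s, F (p, ι s) ∂μ) := by
    intro G _ _ F hF
    have h := continuous_parametric_integral_of_continuous (μ := μ)
      (f := fun p s => F (p, ι s)) (by fun_prop) isCompact_univ
    simpa using h
  induction k with
  | zero =>
    intro G _ _ F hF
    exact contDiff_zero.2 (cont hF.continuous)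
  | succ k ih =>
    intro G _ _ F hF
    refine contDiff_succ_iff_hasFDerivAt.2
      ⟨fun p => ∫ s, (fderiv ℝ F (p, ι s)).comp (ContinuousLinearMap.inl ℝ P E) ∂μ, ?_, ?_⟩
    · exact ih (F := fun q => (fderiv ℝ F q).comp (ContinuousLinearMap.inl ℝ P E))
        ((hF.fderiv_right (m := ∞) (by simp)).clm_comp contDiff_const)
    · intro p
      have hc : Continuous (fun q : P × K =>
          (fderiv ℝ F (q.1, ι q.2)).comp (ContinuousLinearMap.inl ℝ P E)) :=
        ((hF.continuous_fderiv (by simp)).comp (by fun_prop)).clm_comp continuous_const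
      obtain ⟨C, hC⟩ := ((isCompact_closedBall p 1).prod
        (isCompact_univ (X := K))).exists_bound_of_continuousOn hc.continuousOn
      have hFc : ∀ q, Continuous (fun s => F (q, ι s)) := fun q =>
        hF.continuous.comp (by fun_prop)
      refine hasFDerivAt_integral_of_dominated_of_fderiv_le (bound := fun _ => C)
        (F := fun q s => F (q, ι s))
        (F' := fun q s => (fderiv ℝ F (q, ι s)).comp (ContinuousLinearMap.inl ℝ P E))
        (closedBall_mem_nhds p one_pos) ?_ ?_ ?_ ?_ (integrable_const C) ?_
      · exact Filter.Eventually.of_forall fun q =>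
          (hFc q).aestronglyMeasurable_of_compactSpace
      · exact (hFc p).integrable_of_hasCompactSupport (HasCompactSupport.of_compactSpace _)
      · exact (hc.comp (f := fun s => (p, s)) (by fun_prop)).aestronglyMeasurable_of_compactSpace
      · exact Filter.Eventually.of_forall fun s q hq => hC (q, s) ⟨hq, mem_univ s⟩
      · refine Filter.Eventually.of_forall fun s q _ => ?_
        have h1 : HasFDerivAt F (fderiv ℝ F (q, ι s)) (q, ι s) :=
          (hF.differentiable (by simp) _).hasFDerivAt
        exact h1.comp q (hasFDerivAt_prodMk_left q (ι s))

theorem contDiff_infty_integral_compact {P : Type} [NormedAddCommGroup P] [NormedSpace ℝ P]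
    [FiniteDimensional ℝ P] {E : Type*} [NormedAddCommGroup E] [NormedSpace ℝ E]
    {K : Type*} [TopologicalSpace K] [CompactSpace K] [MeasurableSpace K]
    [OpensMeasurableSpace K] [SecondCountableTopology K] (μ : Measure K) [IsFiniteMeasure μ]
    {ι : K → E} (hι : Continuous ι) {G : Type*} [NormedAddCommGroup G] [NormedSpace ℝ G]
    {F : P × E → G} (hF : ContDiff ℝ ∞ F) : ContDiff ℝ ∞ (fun p => ∫ s, F (p, ι s) ∂μ) :=
  contDiff_infty.2 fun k => contDiff_integral_compact μ hι k hF

end ParametricIntegrals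

/-! ### Polar coordinates for functions that need not be radial. -/

section Polar

variable {E : Type*} [NormedAddCommGroup E] [NormedSpace ℝ E] [FiniteDimensional ℝ E]
  [Nontrivial E] [MeasurableSpace E] [BorelSpace E] (μ : Measure E) [μ.IsAddHaarMeasure]
  {G : Type*} [NormedAddCommGroup G] [NormedSpace ℝ G]

theorem integral_eq_integral_Ioi_integral_sphere {F : E → G} (hF : Integrable F μ) :
    ∫ y, F y ∂μ = ∫ t in Ioi (0 : ℝ), t ^ (Module.finrank ℝ E - 1) •
      ∫ s : sphere (0 : E) 1, F (t • (s : E)) ∂μ.toSphere := by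
  have hmp := μ.measurePreserving_homeomorphUnitSphereProd
  have hemb := (homeomorphUnitSphereProd E).measurableEmbedding
  let Φ : sphere (0 : E) 1 × Ioi (0 : ℝ) → G := fun p => F (p.2.1 • (p.1 : E))
  have hΦ : ∀ x : ({(0 : E)}ᶜ : Set E), Φ (homeomorphUnitSphereProd E x) = F x := by
    intro x
    have hx : ‖(x : E)‖ ≠ 0 := norm_ne_zero_iff.2 x.2
    simp [Φ, smul_smul, hx]
  have hint : Integrable Φ
      (μ.toSphere.prod (Measure.volumeIoiPow (Module.finrank ℝ E - 1))) := by
    rw [← hmp.integrable_comp_emb hemb]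
    have : Φ ∘ homeomorphUnitSphereProd E = F ∘ Subtype.val := funext hΦ
    rw [this]
    exact (integrableOn_iff_comap_subtypeVal
      (measurableSet_singleton (0 : E)).compl).1 hF.integrableOn
  calc
    ∫ y, F y ∂μ = ∫ x : ({(0 : E)}ᶜ : Set E), F x ∂(μ.comap (↑)) := by
      rw [integral_subtype_comap (measurableSet_singleton _).compl, restrict_compl_singleton]
    _ = ∫ p, Φ p ∂(μ.toSphere.prod (Measure.volumeIoiPow (Module.finrank ℝ E - 1))) := by
      rw [← hmp.integral_comp hemb]
      exact integral_congr_ae (Filter.Eventually.of_forall fun x => (hΦ x).symm)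
    _ = ∫ t : Ioi (0 : ℝ), (∫ s, F (t.1 • (s : E)) ∂μ.toSphere)
          ∂(Measure.volumeIoiPow (Module.finrank ℝ E - 1)) := integral_prod_symm _ hint
    _ = _ := by
      simp only [Measure.volumeIoiPow, ENNReal.ofReal]
      rw [integral_withDensity_eq_integral_smul (by fun_prop), integral_subtype_comap
        measurableSet_Ioi fun a : ℝ ↦ Real.toNNReal (a ^ (Module.finrank ℝ E - 1)) •
          ∫ s : sphere (0 : E) 1, F (a • (s : E)) ∂μ.toSphere]
      refine setIntegral_congr_fun measurableSet_Ioi fun t ht => ?_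
      simp only [NNReal.smul_def, Real.coe_toNNReal _ (pow_nonneg (le_of_lt ht) _)]

end Polar

/-! ### Integrals over balls and spheres of functions of one linear coordinate. -/

section Slicing

theorem exists_orthonormalBasis_apply_zero_eq {V : Type*} [NormedAddCommGroup V]
    [InnerProductSpace ℝ V] [FiniteDimensional ℝ V] {d : ℕ}
    (hV : Module.finrank ℝ V = d + 1) {v : V} (hv : ‖v‖ = 1) :
    ∃ b : OrthonormalBasis (Fin (d + 1)) ℝ V, b 0 = v := by
  obtain ⟨b, hb⟩ := Orthonormal.exists_orthonormalBasis_extension_of_card_eq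
    (𝕜 := ℝ) (ι := Fin (d + 1)) (by simpa using hV) (v := fun _ => v) (s := {0})
    ⟨fun _ => hv, fun i j hij => absurd (Subsingleton.elim i j) hij⟩
  exact ⟨b, hb 0 rfl⟩

theorem exists_linearIsometryEquiv_apply_eq {V W : Type*} [NormedAddCommGroup V]
    [InnerProductSpace ℝ V] [FiniteDimensional ℝ V] [NormedAddCommGroup W]
    [InnerProductSpace ℝ W] [FiniteDimensional ℝ W] {d : ℕ}
    (hV : Module.finrank ℝ V = d + 1) (hW : Module.finrank ℝ W = d + 1)
    {v : V} {w : W} (hv : ‖v‖ = 1) (hw : ‖w‖ = 1) : ∃ T : V ≃ₗᵢ[ℝ] W, T v = w := by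
  obtain ⟨b, hb⟩ := exists_orthonormalBasis_apply_zero_eq hV hv
  obtain ⟨c, hc⟩ := exists_orthonormalBasis_apply_zero_eq hW hw
  exact ⟨b.equiv c (Equiv.refl _), by rw [← hb, ← hc]; simp⟩

/-- Rotate `e` to the first axis and slice: the slice at height `s` is a `d`-ball of radius `√(R² -
s²)`. For `|s| ≥ R` this root is 0 and the slice is empty, which agrees with the formula because `d
≠ 0`. -/
theorem integral_ball_comp_inner {d : ℕ} (hd : d ≠ 0) {e : EuclideanSpace ℝ (Fin (d + 1))}
    (he : ‖e‖ = 1) {g : ℝ → ℝ} (hg : Continuous g) (R : ℝ) (hR : 0 ≤ R) :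
    ∫ x in ball (0 : EuclideanSpace ℝ (Fin (d + 1))) R, g (inner ℝ e x) =
      volume.real (ball (0 : EuclideanSpace ℝ (Fin d)) 1) *
        ∫ s, g s * √(R ^ 2 - s ^ 2) ^ d := by
  have hw : ‖WithLp.toLp 2 ((1 : ℝ), (0 : EuclideanSpace ℝ (Fin d)))‖ = 1 := by
    rw [WithLp.prod_norm_eq_of_L2]
    simp
  have hWd : Module.finrank ℝ (WithLp 2 (ℝ × EuclideanSpace ℝ (Fin d))) = d + 1 := by
    rw [(WithLp.linearEquiv 2 ℝ (ℝ × EuclideanSpace ℝ (Fin d))).finrank_eq]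
    simp [add_comm]
  obtain ⟨T, hT⟩ := exists_linearIsometryEquiv_apply_eq (by simp) hWd he hw
  have hTs := T.symm.measurePreserving
  have hL := (WithLp.volume_preserving_toLp (U := ℝ) (V := EuclideanSpace ℝ (Fin d)))
  have hin : ∀ y : WithLp 2 (ℝ × EuclideanSpace ℝ (Fin d)), inner ℝ e (T.symm y) = y.fst := by
    intro y
    rw [← T.inner_map_map, hT]
    simp [WithLp.prod_inner_apply]
  have hmem : ∀ q : ℝ × EuclideanSpace ℝ (Fin d),
      T.symm (WithLp.toLp 2 q) ∈ ball (0 : EuclideanSpace ℝ (Fin (d + 1))) R ↔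
        q.2 ∈ ball (0 : EuclideanSpace ℝ (Fin d)) √(R ^ 2 - q.1 ^ 2) := by
    intro q
    rw [mem_ball_zero_iff, mem_ball_zero_iff, T.symm.norm_map,
      Real.lt_sqrt (norm_nonneg _), ← sq_lt_sq₀ (norm_nonneg _) hR,
      WithLp.prod_norm_sq_eq_of_L2]
    simp only [Real.norm_eq_abs, sq_abs, WithLp.toLp_fst, WithLp.toLp_snd]
    constructor <;> intro h <;> linarith
  have hcont : Continuous fun x : EuclideanSpace ℝ (Fin (d + 1)) => g (inner ℝ e x) := by
    fun_prop
  let H : EuclideanSpace ℝ (Fin (d + 1)) → ℝ :=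
    (ball 0 R).indicator fun x => g (inner ℝ e x)
  have hH : Integrable H := by
    refine (integrable_indicator_iff measurableSet_ball).2 ?_
    exact (hcont.continuousOn.integrableOn_compact
      (isCompact_closedBall (0 : EuclideanSpace ℝ (Fin (d + 1))) R)).mono_set
      ball_subset_closedBall
  have hcomp : MeasurePreserving
      (fun q : ℝ × EuclideanSpace ℝ (Fin d) => T.symm (WithLp.toLp 2 q)) := hTs.comp hL
  have hemb : MeasurableEmbedding
      (fun q : ℝ × EuclideanSpace ℝ (Fin d) => T.symm (WithLp.toLp 2 q)) :=
    T.symm.toHomeomorph.measurableEmbedding.comp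
      (WithLp.homeomorphProd 2 ℝ (EuclideanSpace ℝ (Fin d))).symm.measurableEmbedding
  have hHq : ∀ q : ℝ × EuclideanSpace ℝ (Fin d), H (T.symm (WithLp.toLp 2 q)) =
      (ball (0 : EuclideanSpace ℝ (Fin d)) √(R ^ 2 - q.1 ^ 2)).indicator
        (fun _ => g q.1) q.2 := by
    intro q
    by_cases hq : q.2 ∈ ball (0 : EuclideanSpace ℝ (Fin d)) √(R ^ 2 - q.1 ^ 2)
    · rw [indicator_of_mem hq]
      simp only [H]
      rw [indicator_of_mem ((hmem q).2 hq), hin, WithLp.toLp_fst]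
    · rw [indicator_of_notMem hq]
      exact indicator_of_notMem (mt (hmem q).1 hq) _
  rw [← integral_indicator measurableSet_ball, ← hcomp.integral_comp hemb]
  have hint : Integrable (fun q : ℝ × EuclideanSpace ℝ (Fin d) =>
      H (T.symm (WithLp.toLp 2 q))) := (hcomp.integrable_comp_emb hemb).2 hH
  change ∫ q, H (T.symm (WithLp.toLp 2 q)) = _
  rw [Measure.volume_eq_prod] at hint ⊢
  rw [integral_prod _ hint, ← integral_const_mul]
  refine integral_congr_ae (Filter.Eventually.of_forall fun s => ?_)
  simp only [hHq]
  have : Nonempty (Fin d) := ⟨⟨0, Nat.pos_of_ne_zero hd⟩⟩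
  rw [integral_indicator measurableSet_ball, setIntegral_const, measureReal_def,
    Measure.addHaar_ball _ _ (Real.sqrt_nonneg _), ENNReal.toReal_mul,
    ENNReal.toReal_ofReal (by positivity)]
  simp only [finrank_euclideanSpace, Fintype.card_fin, smul_eq_mul, measureReal_def]
  ring

theorem hasDerivAt_integral_mul_sq_sub_sq_pow {g : ℝ → ℝ} (hg : Continuous g) (m : ℕ) (R : ℝ) :
    HasDerivAt (fun R => ∫ s in (-1 : ℝ)..1, g s * (R ^ 2 - s ^ 2) ^ (m + 1))
      (∫ s in (-1 : ℝ)..1, g s * ((m + 1) * (R ^ 2 - s ^ 2) ^ m * (2 * R))) R := by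
  have hc : Continuous fun q : ℝ × ℝ =>
      g q.2 * ((m + 1) * (q.1 ^ 2 - q.2 ^ 2) ^ m * (2 * q.1)) := by fun_prop
  obtain ⟨C, hC⟩ := ((isCompact_closedBall R 1).prod
    (isCompact_Icc (a := (-1 : ℝ)) (b := 1))).exists_bound_of_continuousOn hc.continuousOn
  refine (intervalIntegral.hasDerivAt_integral_of_dominated_loc_of_deriv_le
    (F := fun R s => g s * (R ^ 2 - s ^ 2) ^ (m + 1))
    (F' := fun R s => g s * ((m + 1) * (R ^ 2 - s ^ 2) ^ m * (2 * R))) (bound := fun _ => C)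
    (closedBall_mem_nhds R one_pos) ?_ ?_ ?_ ?_ ?_ ?_).2
  · exact Filter.Eventually.of_forall fun x =>
      Continuous.aestronglyMeasurable (by fun_prop)
  · exact Continuous.intervalIntegrable (by fun_prop) _ _
  · exact Continuous.aestronglyMeasurable (by fun_prop)
  · refine Filter.Eventually.of_forall fun s hs x hx => hC (x, s) ⟨hx, ?_⟩
    rw [uIoc_of_le (by norm_num)] at hs
    exact ⟨hs.1.le, hs.2⟩
  · exact intervalIntegrable_const
  · refine Filter.Eventually.of_forall fun s _ x _ => ?_
    have h := ((((hasDerivAt_id x).pow 2).sub_const (s ^ 2)).pow (m + 1)).const_mul (g s)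
    refine h.congr_deriv ?_
    simp

/-- The sphere integral is the derivative at `R = 1` of the integral over the ball of radius `R`.
Polar coordinates and slicing express the latter in two ways, and their derivatives are compared. -/
theorem integral_sphere_comp_inner (m : ℕ) {e : EuclideanSpace ℝ (Fin (2 * (m + 1) + 1))}
    (he : ‖e‖ = 1) {g : ℝ → ℝ} (hg : Continuous g) {ρ : ℝ} (hρ : ρ < 1)
    (hsupp : ∀ s, ρ ≤ |s| → g s = 0) :
    ∫ σ : sphere (0 : EuclideanSpace ℝ (Fin (2 * (m + 1) + 1))) 1,
        g (inner ℝ e (σ : EuclideanSpace ℝ (Fin (2 * (m + 1) + 1)))) ∂(sphereMeasure _) =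
      volume.real (ball (0 : EuclideanSpace ℝ (Fin (2 * (m + 1)))) 1) *
        ((2 * (m + 1)) * ∫ s in (-1 : ℝ)..1, g s * (1 - s ^ 2) ^ m) := by
  let E := EuclideanSpace ℝ (Fin (2 * (m + 1) + 1))
  set κ := volume.real (ball (0 : EuclideanSpace ℝ (Fin (2 * (m + 1)))) 1)
  let I : ℝ → ℝ := fun t => ∫ σ : sphere (0 : E) 1, g (inner ℝ e (t • (σ : E)))
    ∂(volume : Measure E).toSphere
  have hI : Continuous I := by
    have h := continuous_parametric_integral_of_continuous
      (μ := (volume : Measure E).toSphere)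
      (f := fun (t : ℝ) (σ : sphere (0 : E) 1) => g (inner ℝ e (t • (σ : E))))
      (by fun_prop) isCompact_univ
    simpa using h
  have hpolar : ∀ R : ℝ, 0 < R → ∫ x in ball (0 : E) R, g (inner ℝ e x) =
      ∫ t in (0 : ℝ)..R, t ^ (2 * (m + 1)) * I t := by
    intro R hR
    have hint : IntegrableOn (fun x : E => g (inner ℝ e x)) (ball 0 R) :=
      ((by fun_prop : Continuous fun x : E => g (inner ℝ e x)).continuousOn.integrableOn_compact
        (isCompact_closedBall (0 : E) R)).mono_set ball_subset_closedBall
    rw [← integral_indicator measurableSet_ball,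
      integral_eq_integral_Ioi_integral_sphere _
        ((integrable_indicator_iff measurableSet_ball).2 hint),
      intervalIntegral.integral_of_le hR.le, ← integral_indicator measurableSet_Ioi,
      integral_Ioc_eq_integral_Ioo, ← integral_indicator measurableSet_Ioo]
    refine integral_congr_ae (Filter.Eventually.of_forall fun t => ?_)
    by_cases h0 : 0 < t
    · by_cases h1 : t < R
      · simp [indicator, h0, h1, I, norm_smul, abs_of_pos h0, E]
      · simp [indicator, h0, h1, norm_smul, abs_of_pos h0]
    · simp [indicator, h0]
  -- Since `g` vanishes for `|s| ≥ ρ`, the limits can stay at `±1` and the square root disappears,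
  -- so `R` enters only through a polynomial, on both sides of `R = 1`.
  have hslice : ∀ R : ℝ, 0 < R → ρ < R → ∫ x in ball (0 : E) R, g (inner ℝ e x) =
      κ * ∫ s in (-1 : ℝ)..1, g s * (R ^ 2 - s ^ 2) ^ (m + 1) := by
    intro R hR0 hR
    rw [integral_ball_comp_inner (by omega) he hg R hR0.le]
    congr 1
    rw [intervalIntegral.integral_eq_integral_of_support_subset]
    · refine integral_congr_ae (Filter.Eventually.of_forall fun s => ?_)
      by_cases hs : ρ ≤ |s|
      · simp [hsupp s hs]
      · have : 0 ≤ R ^ 2 - s ^ 2 := by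
          have := abs_lt.1 ((not_le.1 hs).trans hR)
          nlinarith
        simp only [pow_mul, Real.sq_sqrt this]
    · intro s hs
      by_contra h
      apply hs
      have : ρ ≤ |s| := by
        by_contra h'
        have := abs_lt.1 ((not_le.1 h').trans hρ)
        exact h ⟨this.1, this.2.le⟩
      simp [hsupp s this]
  have hd1 : HasDerivAt (fun R => ∫ t in (0 : ℝ)..R, t ^ (2 * (m + 1)) * I t) (I 1) 1 := by
    have hc : Continuous fun t => t ^ (2 * (m + 1)) * I t := by fun_prop
    simpa using (hc.integral_hasStrictDerivAt 0 1).hasDerivAt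
  have hd2 := (hasDerivAt_integral_mul_sq_sub_sq_pow hg m 1).const_mul κ
  have heq : (fun R => ∫ t in (0 : ℝ)..R, t ^ (2 * (m + 1)) * I t) =ᶠ[nhds 1]
      fun R => κ * ∫ s in (-1 : ℝ)..1, g s * (R ^ 2 - s ^ 2) ^ (m + 1) := by
    filter_upwards [lt_mem_nhds hρ, lt_mem_nhds one_pos] with R h1 h2
    rw [← hpolar R h2, hslice R h2 h1]
  have hfin := hd1.unique (hd2.congr_of_eventuallyEq heq)
  simp only [I, one_smul] at hfin
  rw [← intervalIntegral.integral_const_mul]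
  refine hfin.trans (congrArg (κ * ·) (intervalIntegral.integral_congr fun s _ => ?_))
  simp only [one_pow, mul_one]
  ring

end Slicing

/-! ### Sphere integrals of differentiated plane waves. -/

section PlaneWaves

theorem iteratedDeriv_eq_zero_of_lt_abs {p : ℝ → ℝ} {ρ : ℝ} (hsupp : ∀ s, ρ < |s| → p s = 0)
    (k : ℕ) : ∀ s, ρ < |s| → iteratedDeriv k p s = 0 := by
  intro s hs
  have h : p =ᶠ[nhds s] fun _ => 0 :=
    ((isOpen_lt continuous_const continuous_abs).mem_nhds hs : {t : ℝ | ρ < |t|} ∈ nhds s)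
      |> fun h => Filter.mem_of_superset h hsupp
  rw [h.iteratedDeriv_eq k]
  simp

theorem integral_iteratedDeriv_mul_polynomial {p : ℝ → ℝ} (hp : ContDiff ℝ ∞ p) {ρ : ℝ}
    (hρ : ρ < 1) (hsupp : ∀ s, ρ < |s| → p s = 0) (k : ℕ) (q : Polynomial ℝ) :
    ∫ s in (-1 : ℝ)..1, iteratedDeriv k p s * q.eval s =
      (-1) ^ k * ∫ s in (-1 : ℝ)..1, p s * (Polynomial.derivative^[k] q).eval s := by
  induction k generalizing q with
  | zero => simp
  | succ k ih =>
    have hd : ∀ s, HasDerivAt (iteratedDeriv k p) (iteratedDeriv (k + 1) p s) s := by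
      intro s
      rw [iteratedDeriv_succ]
      exact ((hp.differentiable_iteratedDeriv k
        (by exact_mod_cast WithTop.coe_lt_top _)) s).hasDerivAt
    have hc : Continuous (iteratedDeriv (k + 1) p) :=
      hp.continuous_iteratedDeriv (k + 1) (by exact_mod_cast le_top)
    have h1 := iteratedDeriv_eq_zero_of_lt_abs hsupp k 1 (by simpa using hρ)
    have h2 := iteratedDeriv_eq_zero_of_lt_abs hsupp k (-1) (by simpa using hρ)
    have := intervalIntegral.integral_deriv_mul_eq_sub (a := -1) (b := 1)
      (u := iteratedDeriv k p) (u' := iteratedDeriv (k + 1) p)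
      (v := fun s => q.eval s) (v' := fun s => q.derivative.eval s)
      (fun s _ => hd s) (fun s _ => q.hasDerivAt s) (hc.intervalIntegrable _ _)
      (q.derivative.continuous.intervalIntegrable _ _)
    have hi1 : IntervalIntegrable (fun s => iteratedDeriv (k + 1) p s * q.eval s)
        volume (-1) 1 := (hc.mul q.continuous).intervalIntegrable _ _
    have hi2 : IntervalIntegrable (fun s => iteratedDeriv k p s * q.derivative.eval s)
        volume (-1) 1 := ((hp.continuous_iteratedDeriv k (by exact_mod_cast le_top)).mul
          q.derivative.continuous).intervalIntegrable _ _
    rw [h1, h2, zero_mul, zero_mul, sub_zero, intervalIntegral.integral_add hi1 hi2, ih] at this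
    rw [eq_neg_of_add_eq_zero_left this, Function.iterate_succ_apply, pow_succ]
    ring

/-- Only the leading coefficient `(-1)^m` survives. This is where odd dimension enters: the slicing
weight is then a polynomial of degree exactly the number of derivatives available. -/
theorem iterate_derivative_one_sub_sq_pow (m : ℕ) :
    Polynomial.derivative^[2 * m] ((1 - Polynomial.X ^ 2 : Polynomial ℝ) ^ m) =
      Polynomial.C ((-1) ^ m * ((2 * m).factorial : ℝ)) := by
  have hdeg : ((1 - Polynomial.X ^ 2 : Polynomial ℝ) ^ m).natDegree ≤ 2 * m := by
    have h : (1 - Polynomial.X ^ 2 : Polynomial ℝ).natDegree ≤ 2 := by compute_degree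
    calc _ ≤ m * (1 - Polynomial.X ^ 2 : Polynomial ℝ).natDegree :=
          Polynomial.natDegree_pow_le
      _ ≤ 2 * m := by nlinarith
  have hcoeff : ((1 - Polynomial.X ^ 2 : Polynomial ℝ) ^ m).coeff (2 * m) = (-1) ^ m := by
    have h := Polynomial.coeff_pow_of_natDegree_le (p := (1 - Polynomial.X ^ 2 : Polynomial ℝ))
      (m := m) (n := 2) (by compute_degree)
    rw [mul_comm, h]
    simp [Polynomial.coeff_one]
  have h0 : (Polynomial.derivative^[2 * m] ((1 - Polynomial.X ^ 2 : Polynomial ℝ) ^ m)).natDegree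
      ≤ 0 := (Polynomial.natDegree_iterate_derivative _ _).trans (by omega)
  rw [Polynomial.eq_C_of_natDegree_le_zero h0, Polynomial.coeff_iterate_derivative, zero_add,
    hcoeff, Nat.descFactorial_self, nsmul_eq_mul, mul_comm]

/-- The constant relating plane wave averages over the sphere of `ℝ^{2m+3}` to line integrals. -/
noncomputable def planeWaveConst (m : ℕ) : ℝ :=
  volume.real (ball (0 : EuclideanSpace ℝ (Fin (2 * (m + 1)))) 1) *
    ((2 * (m + 1)) * ((-1) ^ m * ((2 * m).factorial : ℝ)))

/-- With `p(s) = ψ(c + ‖v‖s)`, the condition `|c| + η < ‖v‖` puts the support of `p` strictly inside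
`(-1, 1)`, so no boundary terms arise. The chain rule accounts for `‖v‖^{2m}` and the change of
variable in `∫ p` for one more power. -/
theorem integral_sphere_iteratedDeriv_comp_inner (m : ℕ)
    {v : EuclideanSpace ℝ (Fin (2 * (m + 1) + 1))} {ψ : ℝ → ℝ} (hψ : ContDiff ℝ ∞ ψ)
    {η c : ℝ} (hη : 0 ≤ η) (hsupp : ∀ s, η < |s| → ψ s = 0) (hv : |c| + η < ‖v‖) :
    ∫ σ : sphere (0 : EuclideanSpace ℝ (Fin (2 * (m + 1) + 1))) 1,
        iteratedDeriv (2 * m) ψ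
          (c + inner ℝ v (σ : EuclideanSpace ℝ (Fin (2 * (m + 1) + 1)))) ∂(sphereMeasure _) =
      planeWaveConst m * (‖v‖ ^ (2 * m + 1))⁻¹ * ∫ s, ψ s := by
  set β := ‖v‖ with hβ
  have hβ0 : 0 < β := by linarith [abs_nonneg c]
  let p : ℝ → ℝ := fun s => ψ (c + β * s)
  have hp : ContDiff ℝ ∞ p := by fun_prop
  have hρ : (|c| + η) / β < 1 := (div_lt_one hβ0).2 hv
  have hps : ∀ s, (|c| + η) / β < |s| → p s = 0 := by
    intro s hs
    apply hsupp
    rw [div_lt_iff₀ hβ0] at hs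
    have h1 : |β * s| ≤ |c + β * s| + |c| := by
      have := abs_sub (c + β * s) c
      simpa using this
    rw [abs_mul, abs_of_pos hβ0] at h1
    linarith
  have hder : ∀ s, iteratedDeriv (2 * m) p s =
      β ^ (2 * m) * iteratedDeriv (2 * m) ψ (c + β * s) := by
    intro s
    have h1 : p = fun s => (fun t => ψ (c + t)) (β * s) := rfl
    rw [h1, iteratedDeriv_comp_const_mul (f := fun t => ψ (c + t))
      ((hψ.comp (by fun_prop)).of_le (WithTop.coe_le_coe.2 le_top)) β]
    simp [iteratedDeriv_comp_const_add]
  have hcont : Continuous (iteratedDeriv (2 * m) p) :=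
    hp.continuous_iteratedDeriv _ (WithTop.coe_le_coe.2 le_top)
  -- The slicing lemma wants vanishing for `ρ ≤ |s|`, while `p` is only known to vanish for strict
  -- inequality; a slightly larger radius bridges the two.
  obtain ⟨ρ', h1, h2⟩ := exists_between hρ
  have he : ‖β⁻¹ • v‖ = 1 := by
    rw [norm_smul, norm_inv, Real.norm_of_nonneg hβ0.le, ← hβ, inv_mul_cancel₀ hβ0.ne']
  have key := integral_sphere_comp_inner m he hcont h2
    (fun s hs => iteratedDeriv_eq_zero_of_lt_abs hps _ s (h1.trans_le hs))
  have hpoly := integral_iteratedDeriv_mul_polynomial hp hρ hps (2 * m)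
    ((1 - Polynomial.X ^ 2 : Polynomial ℝ) ^ m)
  rw [iterate_derivative_one_sub_sq_pow] at hpoly
  simp only [Polynomial.eval_pow, Polynomial.eval_sub, Polynomial.eval_one, Polynomial.eval_X,
    Polynomial.eval_C] at hpoly
  rw [hpoly, intervalIntegral.integral_mul_const] at key
  have hint : ∫ s in (-1 : ℝ)..1, p s = β⁻¹ * ∫ s, ψ s := by
    simp only [p]
    rw [intervalIntegral.integral_comp_add_mul ψ hβ0.ne' c, smul_eq_mul,
      intervalIntegral.integral_eq_integral_of_support_subset]
    intro s hs
    by_contra h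
    refine hs (hsupp s ?_)
    by_contra h'
    have h3 := abs_le.1 (not_lt.1 h')
    have h4 := abs_le.1 (le_refl |c|)
    exact h ⟨by linarith, by linarith⟩
  rw [hint] at key
  simp only [hder, inner_smul_left, conj_trivial, mul_inv_cancel_left₀ hβ0.ne'] at key
  rw [integral_const_mul] at key
  have : (β ^ (2 * m)) ≠ 0 := by positivity
  apply mul_left_cancel₀ this
  rw [key, planeWaveConst, pow_succ]
  field_simp
  rw [pow_mul, neg_one_sq, one_pow]
  ring

end PlaneWaves

/-! ### The regularized Newtonian kernel and its Laplacian. -/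

section NewtonianPotential

open Filter Topology

variable {E : Type*} [NormedAddCommGroup E] [InnerProductSpace ℝ E]

theorem hasFDerivAt_norm_sq_add_rpow {ε : ℝ} (hε : 0 < ε) (r : ℝ) (z : E) :
    HasFDerivAt (fun z : E => (‖z‖ ^ 2 + ε) ^ r)
      ((r * (‖z‖ ^ 2 + ε) ^ (r - 1)) • ((2 : ℝ) • innerSL ℝ z)) z := by
  have h1 : HasFDerivAt (fun z : E => ‖z‖ ^ 2 + ε) ((2 : ℝ) • innerSL ℝ z) z := by
    refine ((hasStrictFDerivAt_norm_sq z).hasFDerivAt.add_const ε).congr_fderiv ?_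
    ext y
    simp
  exact h1.rpow_const (Or.inl (by positivity))

theorem fderiv_norm_sq_add_rpow_apply {ε : ℝ} (hε : 0 < ε) (r : ℝ) (z v : E) :
    fderiv ℝ (fun z : E => (‖z‖ ^ 2 + ε) ^ r) z v =
      2 * r * (‖z‖ ^ 2 + ε) ^ (r - 1) * inner ℝ z v := by
  rw [(hasFDerivAt_norm_sq_add_rpow hε r z).fderiv]
  simp
  ring

theorem hasFDerivAt_fderiv_norm_sq_add_rpow_apply {ε : ℝ} (hε : 0 < ε) (r : ℝ) (z v : E) :
    HasFDerivAt (fun z : E => fderiv ℝ (fun z : E => (‖z‖ ^ 2 + ε) ^ r) z v)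
      ((2 * r * (‖z‖ ^ 2 + ε) ^ (r - 1)) • innerSL ℝ v + inner ℝ z v •
        ((2 * r) • (((r - 1) * (‖z‖ ^ 2 + ε) ^ (r - 1 - 1)) • ((2 : ℝ) • innerSL ℝ z)))) z := by
  have h : (fun z : E => fderiv ℝ (fun z : E => (‖z‖ ^ 2 + ε) ^ r) z v) =
      fun z => 2 * r * (‖z‖ ^ 2 + ε) ^ (r - 1) * inner ℝ z v :=
    funext fun z => fderiv_norm_sq_add_rpow_apply hε r z v
  rw [h]
  have h2 : HasFDerivAt (fun z : E => inner ℝ z v) (innerSL ℝ v) z := by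
    have := (innerSL ℝ v).hasFDerivAt (x := z)
    refine this.congr_of_eventuallyEq (Eventually.of_forall fun y => ?_)
    simp [real_inner_comm]
  exact ((hasFDerivAt_norm_sq_add_rpow hε (r - 1) z).const_mul (2 * r)).mul h2

/-- For the exponent `r = -(d-2)/2`, `2d + 4(r-1) = 0`, so the `‖z‖²` terms cancel and only a
multiple of `ε` remains. -/
theorem sum_fderiv_fderiv_norm_sq_add_rpow {d : ℕ} (b : OrthonormalBasis (Fin d) ℝ E)
    {ε : ℝ} (hε : 0 < ε) (z : E) :
    ∑ i, fderiv ℝ (fun z : E => fderiv ℝ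
        (fun z : E => (‖z‖ ^ 2 + ε) ^ (-(((d : ℝ) - 2) / 2))) z (b i)) z (b i) =
      -((d : ℝ) * (d - 2)) * (ε * (‖z‖ ^ 2 + ε) ^ (-(((d : ℝ) + 2) / 2))) := by
  set r : ℝ := -(((d : ℝ) - 2) / 2) with hr
  have hq : 0 < ‖z‖ ^ 2 + ε := by positivity
  have h1 : ∀ i, fderiv ℝ (fun z : E => fderiv ℝ
      (fun z : E => (‖z‖ ^ 2 + ε) ^ r) z (b i)) z (b i) =
      2 * r * (‖z‖ ^ 2 + ε) ^ (r - 1) +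
        4 * r * (r - 1) * (‖z‖ ^ 2 + ε) ^ (r - 1 - 1) * (inner ℝ z (b i)) ^ 2 := by
    intro i
    rw [(hasFDerivAt_fderiv_norm_sq_add_rpow_apply hε r z (b i)).fderiv]
    simp
    ring
  have h2 : ∑ i, (inner ℝ z (b i)) ^ 2 = ‖z‖ ^ 2 := by
    rw [← b.sum_sq_norm_inner_right z]
    simp [real_inner_comm]
  have h3 : (‖z‖ ^ 2 + ε) ^ (r - 1) = (‖z‖ ^ 2 + ε) ^ (r - 1 - 1) * (‖z‖ ^ 2 + ε) := by
    conv_rhs => rw [← Real.rpow_one (‖z‖ ^ 2 + ε), ← Real.rpow_mul hq.le, ← Real.rpow_add hq]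
    congr 1
    ring
  have h4 : r - 1 - 1 = -(((d : ℝ) + 2) / 2) := by rw [hr]; ring
  simp only [h1]
  rw [Finset.sum_add_distrib, ← Finset.mul_sum _ _ (4 * r * (r - 1) * _), h2, h3, h4]
  simp only [Finset.sum_const, Finset.card_univ, Fintype.card_fin, nsmul_eq_mul]
  rw [hr]
  ring

theorem fderiv_fderiv_comp_const_sub {F : Type*} [NormedAddCommGroup F] [NormedSpace ℝ F]
    {g : E → F} (hg : ContDiff ℝ ∞ g) (x z v : E) :
    fderiv ℝ (fun z => fderiv ℝ (fun z => g (x - z)) z v) z v =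
      fderiv ℝ (fun y => fderiv ℝ g y v) (x - z) v := by
  have h1 : ∀ {q : E → F}, ContDiff ℝ ∞ q → ∀ z, fderiv ℝ (fun z => q (x - z)) z v =
      -fderiv ℝ q (x - z) v := by
    intro q hq z
    have := (hq.differentiable (by simp) (x - z)).hasFDerivAt.comp z
      ((hasFDerivAt_id z).const_sub x)
    rw [HasFDerivAt.fderiv (f := fun z => q (x - z)) this]
    simp
  have h2 : (fun z => fderiv ℝ (fun z => g (x - z)) z v) = fun z => -fderiv ℝ g (x - z) v :=
    funext fun z => h1 hg z
  have hg1 : ContDiff ℝ ∞ (fun z => fderiv ℝ g z v) :=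
    (hg.fderiv_right (by simp)).clm_apply contDiff_const
  rw [h2, fderiv_fun_neg, _root_.neg_apply, h1 hg1, neg_neg]

theorem contDiff_norm_sq_add_rpow {ε : ℝ} (hε : 0 < ε) (r : ℝ) :
    ContDiff ℝ ∞ (fun z : E => (‖z‖ ^ 2 + ε) ^ r) :=
  ((contDiff_norm_sq ℝ).add contDiff_const).rpow_const_of_ne fun z => by positivity

variable [FiniteDimensional ℝ E] [MeasurableSpace E] [BorelSpace E]
  {F : Type*} [NormedAddCommGroup F] [NormedSpace ℝ F]

theorem integral_smul_fderiv_fderiv {φ : E → ℝ} {h : E → F} (hφ : ContDiff ℝ ∞ φ)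
    (hh : ContDiff ℝ ∞ h) (hc : HasCompactSupport h) (v : E) :
    ∫ z, φ z • fderiv ℝ (fun z => fderiv ℝ h z v) z v =
      ∫ z, fderiv ℝ (fun z => fderiv ℝ φ z v) z v • h z := by
  have hφ1 : ContDiff ℝ ∞ (fun z => fderiv ℝ φ z v) :=
    (hφ.fderiv_right (by simp)).clm_apply contDiff_const
  have hh1 : ContDiff ℝ ∞ (fun z => fderiv ℝ h z v) :=
    (hh.fderiv_right (by simp)).clm_apply contDiff_const
  have hφ2 : Continuous (fun z => fderiv ℝ (fun z => fderiv ℝ φ z v) z v) :=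
    (hφ1.continuous_fderiv (by simp)).clm_apply continuous_const
  have hh2 : Continuous (fun z => fderiv ℝ (fun z => fderiv ℝ h z v) z v) :=
    (hh1.continuous_fderiv (by simp)).clm_apply continuous_const
  have hc1 : HasCompactSupport (fun z => fderiv ℝ h z v) := hc.fderiv_apply ℝ v
  have hc2 : HasCompactSupport (fun z => fderiv ℝ (fun z => fderiv ℝ h z v) z v) :=
    hc1.fderiv_apply ℝ v
  have hi : ∀ {p : E → ℝ} {q : E → F}, Continuous p → Continuous q → HasCompactSupport q →
      Integrable (fun z => p z • q z) := fun hp hq hqc =>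
    (hp.smul hq).integrable_of_hasCompactSupport hqc.smul_left
  rw [integral_smul_fderiv_eq_neg_fderiv_smul_of_integrable
      (hi hφ1.continuous hh1.continuous hc1) (hi hφ.continuous hh2 hc2)
      (hi hφ.continuous hh1.continuous hc1)
      (fun z _ => hφ.differentiable (by simp) z) (fun z _ => hh1.differentiable (by simp) z),
    integral_smul_fderiv_eq_neg_fderiv_smul_of_integrable
      (hi hφ2 hh.continuous hc) (hi hφ1.continuous hh1.continuous hc1)
      (hi hφ1.continuous hh.continuous hc)
      (fun z _ => hφ1.differentiable (by simp) z) (fun z _ => hh.differentiable (by simp) z),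
    neg_neg]

theorem integral_Ioi_pow_mul_one_add_sq_rpow {d : ℕ} (hd : 0 < d) :
    ∫ y in Ioi (0 : ℝ), y ^ (d - 1) * (1 + y ^ 2) ^ (-(((d : ℝ) + 2) / 2)) = 1 / (d : ℝ) := by
  have hd0 : (d : ℝ) ≠ 0 := by positivity
  -- An explicit antiderivative, zero at 0 and tending to `1/d` at infinity.
  let G : ℝ → ℝ := fun y => (1 / d) * (y ^ d * (1 + y ^ 2) ^ (-((d : ℝ) / 2)))
  have hG : ∀ y ∈ Ici (0 : ℝ), HasDerivAt G
      (y ^ (d - 1) * (1 + y ^ 2) ^ (-(((d : ℝ) + 2) / 2))) y := by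
    intro y _
    have hq : 0 < 1 + y ^ 2 := by positivity
    have h1 : HasDerivAt (fun y : ℝ => 1 + y ^ 2) (2 * y) y := by
      simpa using (hasDerivAt_pow 2 y).const_add 1
    have h2 := ((hasDerivAt_pow d y).mul
      (h1.rpow_const (p := -((d : ℝ) / 2)) (Or.inl hq.ne'))).const_mul (1 / (d : ℝ))
    refine h2.congr_deriv ?_
    have e1 : -((d : ℝ) / 2) - 1 = -(((d : ℝ) + 2) / 2) := by ring
    have e2 : (1 + y ^ 2) ^ (-((d : ℝ) / 2)) =
        (1 + y ^ 2) ^ (-(((d : ℝ) + 2) / 2)) * (1 + y ^ 2) := by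
      conv_rhs => rw [← Real.rpow_one (1 + y ^ 2), ← Real.rpow_mul hq.le, ← Real.rpow_add hq]
      congr 1
      ring
    have e3 : y ^ d = y ^ (d - 1) * y := by rw [← pow_succ, Nat.sub_add_cancel hd]
    rw [e1, e2, e3]
    field_simp
    ring
  have hlim : Tendsto G atTop (𝓝 ((1 / d) * 1)) := by
    refine Tendsto.const_mul _ ?_
    have h1 : Tendsto (fun y : ℝ => (1 + (y ^ 2)⁻¹) ^ (-((d : ℝ) / 2))) atTop (𝓝 1) := by
      have h2 : Tendsto (fun y : ℝ => 1 + (y ^ 2)⁻¹) atTop (𝓝 (1 + 0)) :=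
        ((tendsto_pow_atTop two_ne_zero).inv_tendsto_atTop).const_add 1
      have := h2.rpow_const (p := -((d : ℝ) / 2)) (Or.inl (by norm_num))
      simpa using this
    refine h1.congr' ?_
    filter_upwards [eventually_gt_atTop 0] with y hy
    have e1 : 1 + y ^ 2 = y ^ 2 * (1 + (y ^ 2)⁻¹) := by field_simp; ring
    rw [e1, Real.mul_rpow (by positivity) (by positivity), ← mul_assoc]
    have e2 : (y ^ 2) ^ (-((d : ℝ) / 2)) = (y ^ d)⁻¹ := by
      rw [← Real.rpow_natCast, ← Real.rpow_mul hy.le, ← Real.rpow_natCast, ← Real.rpow_neg hy.le]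
      congr 1
      push_cast
      ring
    rw [e2, mul_inv_cancel₀ (by positivity), one_mul]
  rw [integral_Ioi_of_hasDerivAt_of_nonneg' hG (fun y hy => ?_) hlim]
  · simp [G, hd.ne']
  · have : 0 < y := hy
    positivity

end NewtonianPotential

/-! ### Removing the regularization: the fundamental solution of the Laplacian. -/

section NewtonianPotential

open Filter Topology

variable {E : Type*} [NormedAddCommGroup E] [InnerProductSpace ℝ E]
  [FiniteDimensional ℝ E] [MeasurableSpace E] [BorelSpace E]
  {F : Type*} [NormedAddCommGroup F] [NormedSpace ℝ F]

theorem integral_one_add_norm_sq_rpow [Nontrivial E] :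
    ∫ w : E, (1 + ‖w‖ ^ 2) ^ (-(((Module.finrank ℝ E : ℝ) + 2) / 2)) =
      volume.real (ball (0 : E) 1) := by
  have hd : 0 < Module.finrank ℝ E := Module.finrank_pos
  rw [integral_fun_norm_addHaar volume
    (fun y : ℝ => (1 + y ^ 2) ^ (-(((Module.finrank ℝ E : ℝ) + 2) / 2)))]
  simp only [smul_eq_mul, nsmul_eq_mul]
  rw [integral_Ioi_pow_mul_one_add_sq_rpow hd]
  field_simp

theorem tendsto_integral_one_add_norm_sq_rpow_smul [Nontrivial E] [CompleteSpace F] {h : E → F}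
    (hh : Continuous h) (hc : HasCompactSupport h) :
    Tendsto (fun δ : ℝ => ∫ w : E,
      (1 + ‖w‖ ^ 2) ^ (-(((Module.finrank ℝ E : ℝ) + 2) / 2)) • h (δ • w)) (𝓝[>] 0)
      (𝓝 (volume.real (ball (0 : E) 1) • h 0)) := by
  obtain ⟨C, hC⟩ := hc.exists_bound_of_continuous hh
  have hint : Integrable fun w : E =>
      (1 + ‖w‖ ^ 2) ^ (-(((Module.finrank ℝ E : ℝ) + 2) / 2)) := by
    have := integrable_rpow_neg_one_add_norm_sq (E := E) (μ := volume)
      (r := (Module.finrank ℝ E : ℝ) + 2) (by linarith)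
    simpa only [neg_div] using this
  have hcont : Continuous fun w : E =>
      (1 + ‖w‖ ^ 2) ^ (-(((Module.finrank ℝ E : ℝ) + 2) / 2)) :=
    Continuous.rpow_const (by fun_prop) fun w => Or.inl (by positivity)
  rw [← integral_one_add_norm_sq_rpow, ← integral_smul_const]
  refine tendsto_integral_filter_of_dominated_convergence
    (fun w => (1 + ‖w‖ ^ 2) ^ (-(((Module.finrank ℝ E : ℝ) + 2) / 2)) * C) ?_ ?_
    (hint.mul_const C) ?_
  · exact Eventually.of_forall fun δ => Continuous.aestronglyMeasurable (by fun_prop)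
  · refine Eventually.of_forall fun δ => Eventually.of_forall fun w => ?_
    rw [norm_smul, Real.norm_of_nonneg (by positivity)]
    gcongr
    exact hC _
  · refine Eventually.of_forall fun w => ?_
    have : Tendsto (fun δ : ℝ => h (δ • w)) (𝓝 0) (𝓝 (h ((0 : ℝ) • w))) :=
      Continuous.tendsto (by fun_prop) 0
    rw [zero_smul] at this
    exact (this.mono_left nhdsWithin_le_nhds).const_smul _

/-- Under `z = δw` the powers `δ² · δ^{-(d+2)} · δ^d` cancel: the Laplacian of the regularized
kernel is, up to a constant factor, an approximate identity. -/
theorem integral_norm_sq_add_rpow_smul {δ : ℝ} (hδ : 0 < δ) (h : E → F) :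
    ∫ z : E, (δ ^ 2 * (‖z‖ ^ 2 + δ ^ 2) ^ (-(((Module.finrank ℝ E : ℝ) + 2) / 2))) • h z =
      ∫ w : E, (1 + ‖w‖ ^ 2) ^ (-(((Module.finrank ℝ E : ℝ) + 2) / 2)) • h (δ • w) := by
  set d := Module.finrank ℝ E with hd
  have h1 := Measure.integral_comp_smul_of_nonneg (volume : Measure E)
    (fun z => (δ ^ 2 * (‖z‖ ^ 2 + δ ^ 2) ^ (-(((d : ℝ) + 2) / 2))) • h z) δ (hR := hδ.le)
  rw [← hd] at h1
  rw [eq_comm, inv_smul_eq_iff₀ (by positivity), ← integral_smul] at h1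
  rw [h1]
  refine integral_congr_ae (Eventually.of_forall fun w => ?_)
  simp only [smul_smul]
  congr 1
  have e1 : ‖δ • w‖ ^ 2 + δ ^ 2 = δ ^ 2 * (1 + ‖w‖ ^ 2) := by
    rw [norm_smul, Real.norm_of_nonneg hδ.le]
    ring
  have e2 : (δ ^ 2) ^ (-(((d : ℝ) + 2) / 2)) = (δ ^ (d + 2))⁻¹ := by
    rw [← Real.rpow_natCast δ 2, ← Real.rpow_mul hδ.le, ← Real.rpow_natCast δ (d + 2),
      ← Real.rpow_neg hδ.le]
    congr 1
    push_cast
    ring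
  rw [e1, Real.mul_rpow (by positivity) (by positivity), e2, pow_add]
  field_simp

theorem locallyIntegrable_norm_pow_inv {k : ℕ} (hk : k < Module.finrank ℝ E) :
    LocallyIntegrable (fun z : E => (‖z‖ ^ k)⁻¹) := by
  refine locallyIntegrable_of_norm_le_rpow (C := 1) (α := k) (by omega) (by exact_mod_cast hk)
    (Eventually.of_forall fun z => ?_) (Measurable.aestronglyMeasurable (by fun_prop))
  rw [one_mul, Real.rpow_neg (norm_nonneg _), Real.rpow_natCast, norm_inv, norm_pow, norm_norm]

theorem integrable_norm_pow_inv_smul {k : ℕ} (hk : k < Module.finrank ℝ E) {h : E → F}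
    (hh : Continuous h) (hc : HasCompactSupport h) :
    Integrable (fun z : E => (‖z‖ ^ k)⁻¹ • h z) :=
  (locallyIntegrable_norm_pow_inv hk).integrable_smul_right_of_hasCompactSupport hh hc

/-- The exponent is negative, so the regularized kernel lies below the singular one, which is
locally integrable and serves as dominating function. -/
theorem tendsto_integral_norm_sq_add_rpow_smul {d : ℕ} (hd : 3 ≤ d)
    (hE : Module.finrank ℝ E = d) {h : E → F}
    (hh : Continuous h) (hc : HasCompactSupport h) :
    Tendsto (fun δ : ℝ => ∫ z : E, (‖z‖ ^ 2 + δ ^ 2) ^ (-(((d : ℝ) - 2) / 2)) • h z) (𝓝[>] 0)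
      (𝓝 (∫ z : E, (‖z‖ ^ (d - 2))⁻¹ • h z)) := by
  have : Nontrivial E := Module.nontrivial_of_finrank_pos (R := ℝ) (by omega)
  have hpow : ∀ z : E, z ≠ 0 → (‖z‖ ^ 2) ^ (-(((d : ℝ) - 2) / 2)) = (‖z‖ ^ (d - 2))⁻¹ := by
    intro z hz
    rw [← Real.rpow_natCast, ← Real.rpow_mul (norm_nonneg z), ← Real.rpow_natCast,
      ← Real.rpow_neg (norm_nonneg z), Nat.cast_sub (by omega)]
    congr 1
    push_cast
    ring
  have hne : ∀ᵐ z : E, z ≠ 0 := by simp [ae_iff]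
  refine tendsto_integral_filter_of_dominated_convergence
    (fun z => ‖(‖z‖ ^ (d - 2))⁻¹ • h z‖) ?_ ?_
    (integrable_norm_pow_inv_smul (by omega) hh hc).norm ?_
  · filter_upwards [self_mem_nhdsWithin] with δ hδ
    have hδ : 0 < δ := hδ
    refine Continuous.aestronglyMeasurable (Continuous.smul ?_ hh)
    exact Continuous.rpow_const (by fun_prop) fun w => Or.inl (by positivity)
  · filter_upwards [self_mem_nhdsWithin] with δ hδ
    filter_upwards [hne] with z hz
    have hz' : 0 < ‖z‖ := norm_pos_iff.2 hz
    have hd' : (3 : ℝ) ≤ d := by exact_mod_cast hd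
    rw [norm_smul, norm_smul, ← hpow z hz, Real.norm_of_nonneg (by positivity),
      Real.norm_of_nonneg (by positivity)]
    gcongr ?_ * _
    exact Real.rpow_le_rpow_of_nonpos (by positivity) (by nlinarith) (by linarith)
  · filter_upwards [hne] with z hz
    have hz' : 0 < ‖z‖ := norm_pos_iff.2 hz
    refine Tendsto.smul_const ?_ _
    rw [← hpow z hz]
    have h1 : Tendsto (fun δ : ℝ => ‖z‖ ^ 2 + δ ^ 2) (𝓝[>] 0) (𝓝 (‖z‖ ^ 2 + 0 ^ 2)) :=
      (Continuous.tendsto (by fun_prop) 0).mono_left nhdsWithin_le_nhds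
    have h2 := h1.rpow_const (p := -(((d : ℝ) - 2) / 2)) (Or.inl (by positivity))
    simpa using h2

/-- Both sides are the limit, as `δ → 0`, of the same integral against the regularized kernel:
directly on the left, and after two integrations by parts, through the approximate identity, on the
right. -/
theorem integral_norm_pow_inv_smul_sum_fderiv_fderiv [CompleteSpace F] {d : ℕ} (hd : 3 ≤ d)
    (b : OrthonormalBasis (Fin d) ℝ E) {h : E → F} (hh : ContDiff ℝ ∞ h)
    (hc : HasCompactSupport h) :
    ∫ z, (‖z‖ ^ (d - 2))⁻¹ • ∑ i, fderiv ℝ (fun z => fderiv ℝ h z (b i)) z (b i) =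
      -((d : ℝ) * (d - 2) * volume.real (ball (0 : E) 1)) • h 0 := by
  have hE : Module.finrank ℝ E = d := by
    rw [Module.finrank_eq_card_basis b.toBasis, Fintype.card_fin]
  have : Nontrivial E := Module.nontrivial_of_finrank_pos (R := ℝ) (by omega)
  have hh1 : ∀ i, ContDiff ℝ ∞ (fun z => fderiv ℝ h z (b i)) := fun i =>
    (hh.fderiv_right (by simp)).clm_apply contDiff_const
  have hh2 : ∀ i, Continuous (fun z => fderiv ℝ (fun z => fderiv ℝ h z (b i)) z (b i)) :=
    fun i => ((hh1 i).continuous_fderiv (by simp)).clm_apply continuous_const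
  have hc2 : ∀ i, HasCompactSupport
      (fun z => fderiv ℝ (fun z => fderiv ℝ h z (b i)) z (b i)) :=
    fun i => (hc.fderiv_apply ℝ (b i)).fderiv_apply ℝ (b i)
  have hL : Continuous fun z => ∑ i, fderiv ℝ (fun z => fderiv ℝ h z (b i)) z (b i) :=
    continuous_finsetSum _ fun i _ => hh2 i
  have hLc : HasCompactSupport
      fun z => ∑ i, fderiv ℝ (fun z => fderiv ℝ h z (b i)) z (b i) := by
    refine HasCompactSupport.intro hc fun z hz => Finset.sum_eq_zero fun i _ => ?_
    have := image_eq_zero_of_notMem_tsupport (f := fun z =>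
      fderiv ℝ (fun z => fderiv ℝ h z (b i)) z (b i)) (x := z)
    refine this fun hz' => hz ?_
    exact (tsupport_fderiv_apply_subset ℝ (b i)).trans
      (tsupport_fderiv_apply_subset ℝ (b i)) hz'
  refine tendsto_nhds_unique (tendsto_integral_norm_sq_add_rpow_smul hd hE hL hLc) ?_
  have hlim := (tendsto_integral_one_add_norm_sq_rpow_smul hh.continuous hc).const_smul
    (-((d : ℝ) * (d - 2)))
  rw [smul_smul, neg_mul] at hlim
  refine hlim.congr' ?_
  filter_upwards [self_mem_nhdsWithin] with δ hδ
  have hδ : 0 < δ := hδ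
  have hφ : ContDiff ℝ ∞ (fun z : E => (‖z‖ ^ 2 + δ ^ 2) ^ (-(((d : ℝ) - 2) / 2))) :=
    contDiff_norm_sq_add_rpow (by positivity) _
  have hφ2 : ∀ i, Continuous (fun z => fderiv ℝ (fun z => fderiv ℝ
      (fun z : E => (‖z‖ ^ 2 + δ ^ 2) ^ (-(((d : ℝ) - 2) / 2))) z (b i)) z (b i)) := fun i =>
    ContDiff.continuous_fderiv ((hφ.fderiv_right (m := ∞) (by simp)).clm_apply contDiff_const)
      (by simp) |>.clm_apply continuous_const
  have hi1 : ∀ i ∈ Finset.univ, Integrable (fun z : E =>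
      (‖z‖ ^ 2 + δ ^ 2) ^ (-(((d : ℝ) - 2) / 2)) •
        fderiv ℝ (fun z => fderiv ℝ h z (b i)) z (b i)) := fun i _ =>
    (hφ.continuous.smul (hh2 i)).integrable_of_hasCompactSupport (hc2 i).smul_left
  have hi2 : ∀ i ∈ Finset.univ, Integrable (fun z : E => fderiv ℝ (fun z => fderiv ℝ
      (fun z : E => (‖z‖ ^ 2 + δ ^ 2) ^ (-(((d : ℝ) - 2) / 2))) z (b i)) z (b i) • h z) :=
    fun i _ => ((hφ2 i).smul hh.continuous).integrable_of_hasCompactSupport hc.smul_left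
  rw [← integral_norm_sq_add_rpow_smul hδ, hE, ← integral_smul]
  simp only [Finset.smul_sum]
  rw [integral_finsetSum _ hi1]
  simp only [integral_smul_fderiv_fderiv hφ hh hc]
  rw [← integral_finsetSum _ hi2]
  refine integral_congr_ae (Eventually.of_forall fun z => ?_)
  simp only [← Finset.sum_smul]
  rw [sum_fderiv_fderiv_norm_sq_add_rpow b (by positivity), smul_smul]

open scoped Convolution

theorem fderiv_convolution_lsmul_apply [CompleteSpace F] {k : E → ℝ} (hk : LocallyIntegrable k)
    {g : E → F} (hg : ContDiff ℝ ∞ g) (hc : HasCompactSupport g) (x v : E) :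
    fderiv ℝ (k ⋆[ContinuousLinearMap.lsmul ℝ ℝ] g) x v =
      (k ⋆[ContinuousLinearMap.lsmul ℝ ℝ] fun y => fderiv ℝ g y v) x := by
  rw [(hc.hasFDerivAt_convolution_right _ hk (hg.of_le (by simp)) x).fderiv,
    convolution_precompR_apply _ hk (hc.fderiv ℝ) (hg.continuous_fderiv (by simp))]

theorem contDiff_newtonianPotential [CompleteSpace F] {d : ℕ} (hd : 3 ≤ d)
    (hE : Module.finrank ℝ E = d) {g : E → F} (hg : ContDiff ℝ ∞ g)
    (hc : HasCompactSupport g) :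
    ContDiff ℝ ∞ ((fun z : E => (‖z‖ ^ (d - 2))⁻¹) ⋆[ContinuousLinearMap.lsmul ℝ ℝ] g) :=
  hc.contDiff_convolution_right _ (locallyIntegrable_norm_pow_inv (by omega)) hg

/-- Both derivatives of the convolution fall on `g`, never on the singular kernel; the previous
integral identity then applies to `z ↦ g (x - z)`. -/
theorem laplacian_newtonianPotential [CompleteSpace F] {d : ℕ} (hd : 3 ≤ d)
    (hE : Module.finrank ℝ E = d) {g : E → F} (hg : ContDiff ℝ ∞ g)
    (hc : HasCompactSupport g) (x : E) :
    Laplacian.laplacian ((fun z : E => (‖z‖ ^ (d - 2))⁻¹) ⋆[ContinuousLinearMap.lsmul ℝ ℝ] g) x =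
      -((d : ℝ) * (d - 2) * volume.real (ball (0 : E) 1)) • g x := by
  subst hE
  set d := Module.finrank ℝ E
  set k : E → ℝ := fun z => (‖z‖ ^ (d - 2))⁻¹ with hk_def
  have hk : LocallyIntegrable k := locallyIntegrable_norm_pow_inv (by omega)
  let b := stdOrthonormalBasis ℝ E
  have hg1 : ∀ v, ContDiff ℝ ∞ (fun z => fderiv ℝ g z v) := fun v =>
    (hg.fderiv_right (by simp)).clm_apply contDiff_const
  have hcont2 : ∀ v, Continuous (fun y => fderiv ℝ (fun y => fderiv ℝ g y v) y v) := fun v =>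
    ((hg1 v).continuous_fderiv (by simp)).clm_apply continuous_const
  have hu := contDiff_newtonianPotential hd rfl hg hc
  have hsecond : ∀ v, iteratedFDeriv ℝ 2 (k ⋆[ContinuousLinearMap.lsmul ℝ ℝ] g) x ![v, v] =
      (k ⋆[ContinuousLinearMap.lsmul ℝ ℝ] fun y => fderiv ℝ (fun y => fderiv ℝ g y v) y v) x := by
    intro v
    rw [iteratedFDeriv_two_apply]
    simp only [Matrix.cons_val_zero, Matrix.cons_val_one]
    have hdiff : DifferentiableAt ℝ (fderiv ℝ (k ⋆[ContinuousLinearMap.lsmul ℝ ℝ] g)) x :=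
      (hu.fderiv_right (m := ∞) (by simp)).differentiable (by simp) x
    have h1 : fderiv ℝ (fderiv ℝ (k ⋆[ContinuousLinearMap.lsmul ℝ ℝ] g)) x v v =
        fderiv ℝ (fun y => fderiv ℝ (k ⋆[ContinuousLinearMap.lsmul ℝ ℝ] g) y v) x v := by
      rw [fderiv_clm_apply hdiff (differentiableAt_const v)]
      simp
    have h2 : (fun y => fderiv ℝ (k ⋆[ContinuousLinearMap.lsmul ℝ ℝ] g) y v) =
        k ⋆[ContinuousLinearMap.lsmul ℝ ℝ] fun y => fderiv ℝ g y v :=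
      funext fun y => fderiv_convolution_lsmul_apply hk hg hc y v
    rw [h1, h2, fderiv_convolution_lsmul_apply hk (hg1 v) (hc.fderiv_apply ℝ v)]
  rw [InnerProductSpace.laplacian_eq_iteratedFDeriv_orthonormalBasis _ b]
  simp only [hsecond, convolution_def, ContinuousLinearMap.lsmul_apply]
  have hhc : HasCompactSupport fun z => g (x - z) :=
    hc.comp_homeomorph (Homeomorph.subLeft x)
  have key := integral_norm_pow_inv_smul_sum_fderiv_fderiv hd b
    (h := fun z => g (x - z)) (hg.comp (by fun_prop)) hhc
  simp only [fderiv_fderiv_comp_const_sub hg, sub_zero] at key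
  rw [← key, ← integral_finsetSum]
  · simp only [Finset.smul_sum, hk_def]
    rfl
  · intro i _
    refine integrable_norm_pow_inv_smul (by omega) ((hcont2 (b i)).comp (by fun_prop)) ?_
    exact ((hc.fderiv_apply ℝ (b i)).fderiv_apply ℝ (b i)).comp_homeomorph (Homeomorph.subLeft x)

end NewtonianPotential

/-! ### Evaluation of the constants. -/

section Constants

theorem sphereArea_eq {n : ℕ} (hn : 0 < n) :
    sphereArea n = n * volume.real (ball (0 : EuclideanSpace ℝ (Fin n)) 1) := by
  have : Nonempty (Fin n) := ⟨⟨0, hn⟩⟩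
  have hn' : (n : ℝ) / 2 ≠ 0 := by positivity
  have hG : Real.Gamma ((n : ℝ) / 2) ≠ 0 := (Real.Gamma_pos_of_pos (by positivity)).ne'
  rw [sphereArea, measureReal_def, EuclideanSpace.volume_ball, ENNReal.toReal_mul]
  simp only [ENNReal.ofReal_one, one_pow, ENNReal.toReal_one, one_mul, Fintype.card_fin]
  rw [ENNReal.toReal_ofReal (by positivity), Real.Gamma_add_one hn', Real.sqrt_eq_rpow,
    ← Real.rpow_natCast, ← Real.rpow_mul Real.pi_pos.le]
  have : (1 / 2 : ℝ) * n = n / 2 := by ring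
  rw [this]
  field_simp

theorem sphereArea_pos {n : ℕ} (hn : 0 < n) : 0 < sphereArea n := by
  have : 0 < Real.Gamma ((n : ℝ) / 2) := Real.Gamma_pos_of_pos (by positivity)
  rw [sphereArea]
  positivity

theorem planeWaveConst_eq (m : ℕ) : planeWaveConst m =
    (-1) ^ m * (2 * Real.pi ^ (m + 1) * (2 * m).factorial / m.factorial) := by
  have : Nonempty (Fin (2 * (m + 1))) := ⟨⟨0, by omega⟩⟩
  rw [planeWaveConst, measureReal_def, EuclideanSpace.volume_ball, ENNReal.toReal_mul]
  simp only [ENNReal.ofReal_one, one_pow, ENNReal.toReal_one, one_mul, Fintype.card_fin]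
  have h1 : ((2 * (m + 1) : ℕ) : ℝ) / 2 + 1 = ((m + 1 : ℕ) : ℝ) + 1 := by
    push_cast
    ring
  rw [ENNReal.toReal_ofReal (by positivity), h1, Real.Gamma_nat_eq_factorial, pow_mul,
    Real.sq_sqrt Real.pi_pos.le, Nat.factorial_succ]
  push_cast
  field_simp

/-- Uses `Γ(m + 3/2) = (2m+1)‼ √π / 2^{m+1}` and `(2m+1)! = (2m+1)‼ 2^m m!`; the sign is `(-1)^{m+1}
(-1)^m`. -/
theorem inversionConst_mul_planeWaveConst (m : ℕ) :
    inversionConst (2 * (m + 1) + 1) * (planeWaveConst m * (2 * m + 1) / 2 ^ (2 * m)) = -1 := by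
  have hpi := Real.pi_pos
  have h1 : (2 * (m + 1) + 1 - 1) / 2 = m + 1 := by omega
  have h2 : ((2 * (m + 1) + 1 : ℕ) : ℝ) / 2 = ((m + 1 : ℕ) : ℝ) + 1 / 2 := by
    push_cast
    ring
  have h3 : ((m + 1 : ℕ) : ℝ) + 1 / 2 - 1 = (m : ℝ) + 1 / 2 := by
    push_cast
    ring
  have h4 : 2 * (m + 1) - 1 = 2 * m + 1 := by omega
  have h5 : ((2 * m).factorial : ℝ) * (2 * m + 1) =
      (Nat.doubleFactorial (2 * m + 1) : ℝ) * (2 ^ m * m.factorial) := by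
    have := Nat.factorial_eq_mul_doubleFactorial (2 * m)
    rw [Nat.doubleFactorial_two_mul, Nat.factorial_succ, mul_comm] at this
    exact_mod_cast this
  have h6 : (0 : ℝ) < Nat.doubleFactorial (2 * m + 1) := by
    exact_mod_cast Nat.doubleFactorial_pos _
  rw [inversionConst, planeWaveConst_eq, h1, h2, h3, Real.Gamma_nat_add_half, h4,
    Real.rpow_add hpi, Real.rpow_natCast, ← Real.sqrt_eq_rpow]
  have h7 : √Real.pi * √Real.pi = Real.pi := Real.mul_self_sqrt hpi.le
  have h8 : (-1 : ℝ) ^ m * (-1) ^ m = 1 := by rw [← mul_pow]; simp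
  have hm : (m.factorial : ℝ) ≠ 0 := by positivity
  have hA : ((2 * m).factorial : ℝ) =
      (Nat.doubleFactorial (2 * m + 1) : ℝ) * (2 ^ m * m.factorial) / (2 * m + 1) := by
    rw [eq_div_iff (by positivity), h5]
  have hB : 4 * (Real.pi ^ m * √Real.pi) *
      ((Nat.doubleFactorial (2 * m + 1) : ℝ) * √Real.pi / 2 ^ (m + 1)) =
      2 * Real.pi ^ (m + 1) * (Nat.doubleFactorial (2 * m + 1) : ℝ) / 2 ^ m := by
    calc _ = 4 * Real.pi ^ m * (√Real.pi * √Real.pi) *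
          (Nat.doubleFactorial (2 * m + 1) : ℝ) / 2 ^ (m + 1) := by ring
      _ = _ := by
        rw [h7, pow_succ, pow_succ]
        field_simp
        ring
  rw [hB, hA, pow_succ (-1 : ℝ) m]
  have h9 : (2 : ℝ) ^ (2 * m) = 2 ^ m * 2 ^ m := by rw [two_mul, pow_add]
  rw [h9]
  field_simp
  linear_combination -h8

end Constants

/-! ### Spherical means and the operator `D`. -/

section SphericalMeans

variable {𝕜 : Type*} [RCLike 𝕜]

/-- Joint smoothness in the parameter and `t` is kept, since the center `θ` and the radius `|x - θ|`
later vary together. The factor `1/(2t)` restricts it to `t > 0`. -/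
theorem contDiffOn_iterate_opD {E : Type*} [NormedAddCommGroup E] [NormedSpace ℝ E]
    {Φ : E × ℝ → 𝕜} (hΦ : ContDiffOn ℝ ∞ Φ (univ ×ˢ Ioi 0)) (k : ℕ) :
    ContDiffOn ℝ ∞ (fun p : E × ℝ => opD^[k] (fun t => Φ (p.1, t)) p.2) (univ ×ˢ Ioi 0) := by
  induction k with
  | zero => simpa using hΦ
  | succ k ih =>
    have hopen : IsOpen ((univ : Set E) ×ˢ Ioi (0 : ℝ)) := isOpen_univ.prod isOpen_Ioi
    set Ψ : E × ℝ → 𝕜 := fun p => opD^[k] (fun t => Φ (p.1, t)) p.2 with hΨ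
    have h1 : ContDiffOn ℝ ∞ (fun p : E × ℝ => (1 / (2 * p.2)) • fderiv ℝ Ψ p (0, 1))
        (univ ×ˢ Ioi 0) := by
      have h2 : ContDiffOn ℝ ∞ (fun p : E × ℝ => 1 / (2 * p.2)) (univ ×ˢ Ioi 0) := by
        refine contDiffOn_const.div (by fun_prop) fun p hp => ?_
        have : 0 < p.2 := hp.2
        positivity
      have h3 : ContDiffOn ℝ ∞ (fun p : E × ℝ => fderiv ℝ Ψ p (0, 1)) (univ ×ˢ Ioi 0) :=
        (ih.fderiv_of_isOpen (m := ∞) hopen (by simp)).clm_apply contDiffOn_const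
      exact h2.smul h3
    refine h1.congr fun p hp => ?_
    rw [Function.iterate_succ_apply', opD]
    congr 1
    have hd : DifferentiableAt ℝ Ψ (p.1, p.2) :=
      (ih.contDiffAt (hopen.mem_nhds hp)).differentiableAt (by simp)
    have hc : HasDerivAt (fun t : ℝ => (p.1, t)) ((0 : E), (1 : ℝ)) p.2 :=
      (hasDerivAt_const _ _).prodMk (hasDerivAt_id _)
    exact (hd.hasFDerivAt.comp_hasDerivAt p.2 hc).deriv

theorem contDiffOn_iterate_opD_real {g : ℝ → 𝕜} (hg : ContDiffOn ℝ ∞ g (Ioi 0)) (k : ℕ) :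
    ContDiffOn ℝ ∞ (opD^[k] g) (Ioi 0) := by
  have h := contDiffOn_iterate_opD (E := ℝ) (Φ := fun p => g p.2)
    (hg.comp contDiff_snd.contDiffOn fun p hp => hp.2) k
  exact h.comp (f := fun t => ((0 : ℝ), t)) (by fun_prop) fun t ht => ⟨mem_univ _, ht⟩

/-- In the variable `t²` the operator is plain differentiation and `2t dt` is the line element, so
each integration by parts moves one derivative onto `ψ`. The index `j` is free because `ψ` gains a
derivative at each step. -/
theorem integral_iteratedDeriv_comp_sq_smul_iterate_opD {g : ℝ → 𝕜}
    (hg : ContDiffOn ℝ ∞ g (Ioi 0)) {ψ : ℝ → ℝ} (hψ : ContDiff ℝ ∞ ψ) {a b : ℝ} (ha : 0 < a)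
    (hab : a ≤ b) (hψa : ∀ j, iteratedDeriv j ψ (a ^ 2) = 0)
    (hψb : ∀ j, iteratedDeriv j ψ (b ^ 2) = 0) (k j : ℕ) :
    ∫ t in a..b, (2 * t * iteratedDeriv j ψ (t ^ 2)) • opD^[k] g t =
      (-1 : ℝ) ^ k • ∫ t in a..b, (2 * t * iteratedDeriv (j + k) ψ (t ^ 2)) • g t := by
  induction k generalizing j with
  | zero => simp
  | succ k ih =>
    have hG := contDiffOn_iterate_opD_real hg k
    set G := opD^[k] g
    have hpos : ∀ t ∈ uIcc a b, 0 < t := fun t ht => by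
      rw [uIcc_of_le hab] at ht
      exact ha.trans_le ht.1
    have hψc : ∀ i, Continuous (iteratedDeriv i ψ) := fun i =>
      hψ.continuous_iteratedDeriv i (WithTop.coe_le_coe.2 le_top)
    have hu : ∀ t ∈ uIcc a b, HasDerivAt (fun t => iteratedDeriv j ψ (t ^ 2))
        (2 * t * iteratedDeriv (j + 1) ψ (t ^ 2)) t := by
      intro t _
      have h1 : HasDerivAt (iteratedDeriv j ψ) (iteratedDeriv (j + 1) ψ (t ^ 2)) (t ^ 2) := by
        rw [iteratedDeriv_succ]
        exact ((hψ.differentiable_iteratedDeriv j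
          (by exact_mod_cast WithTop.coe_lt_top _)) _).hasDerivAt
      have h2 := HasDerivAt.comp (h₂ := iteratedDeriv j ψ) (h := fun t => t ^ 2) t h1
        (hasDerivAt_pow 2 t)
      refine h2.congr_deriv ?_
      simp
      ring
    have hv : ∀ t ∈ uIcc a b, HasDerivAt G (deriv G t) t := fun t ht =>
      ((hG.contDiffAt (Ioi_mem_nhds (hpos t ht))).differentiableAt (by simp)).hasDerivAt
    have hGd : ContinuousOn (deriv G) (uIcc a b) :=
      (hG.continuousOn_deriv_of_isOpen isOpen_Ioi (by simp)).mono hpos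
    have hibp := intervalIntegral.integral_smul_deriv_eq_deriv_smul hu hv
      (Continuous.intervalIntegrable (by have := hψc (j + 1); fun_prop) _ _)
      hGd.intervalIntegrable
    rw [hψa, hψb, zero_smul, zero_smul, sub_zero, zero_sub, ih (j + 1)] at hibp
    have hcongr : ∫ t in a..b, (2 * t * iteratedDeriv j ψ (t ^ 2)) • opD^[k + 1] g t =
        ∫ t in a..b, iteratedDeriv j ψ (t ^ 2) • deriv G t := by
      refine intervalIntegral.integral_congr fun t ht => ?_
      have := hpos t ht
      simp only [Function.iterate_succ_apply', opD, smul_smul, G]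
      congr 1
      field_simp
    rw [hcongr, hibp, pow_succ, add_assoc, add_comm 1 k]
    simp

variable {n : ℕ} {f : EuclideanSpace ℝ (Fin n) → 𝕜}

theorem contDiff_sphericalMean (hf : ContDiff ℝ ∞ f) :
    ContDiff ℝ ∞ fun p : EuclideanSpace ℝ (Fin n) × ℝ => sphericalMean f p.1 p.2 := by
  unfold sphericalMean sphereMeasure
  refine ContDiff.const_smul _ ?_
  exact contDiff_infty_integral_compact
    (P := EuclideanSpace ℝ (Fin n) × ℝ) (E := EuclideanSpace ℝ (Fin n))
    (F := fun q => f (q.1.1 - q.1.2 • q.2)) _ continuous_subtype_val (hf.comp (by fun_prop))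

theorem contDiffOn_filteredMean (hf : ContDiff ℝ ∞ f) :
    ContDiffOn ℝ ∞ (fun p : EuclideanSpace ℝ (Fin n) × ℝ => filteredMean f p.1 p.2)
      (univ ×ˢ Ioi 0) :=
  contDiffOn_iterate_opD (Φ := fun p => p.2 ^ (n - 2) • sphericalMean f p.1 p.2)
    (((contDiff_snd.pow _).smul (contDiff_sphericalMean hf)).contDiffOn) (n - 3)

theorem contDiff_sphericalMean_right (hf : ContDiff ℝ ∞ f) (θ : EuclideanSpace ℝ (Fin n)) :
    ContDiff ℝ ∞ (sphericalMean f θ) :=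
  (contDiff_sphericalMean hf).comp (contDiff_prodMk_right θ)

theorem integral_comp_norm_sq_smul_eq_integral_sphericalMean (hn : 2 ≤ n) (hf : Continuous f)
    (hc : HasCompactSupport f) {q : ℝ → ℝ} (hq : Continuous q) (θ : EuclideanSpace ℝ (Fin n)) :
    ∫ y, q (‖θ - y‖ ^ 2) • f y =
      sphereArea n • ∫ t in Ioi (0 : ℝ), (q (t ^ 2) * t ^ (n - 1)) • sphericalMean f θ t := by
  have : Nonempty (Fin n) := ⟨⟨0, by omega⟩⟩
  have hcont : Continuous fun y => q (‖y‖ ^ 2) • f (θ - y) := by fun_prop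
  have hc' : HasCompactSupport fun y => f (θ - y) := hc.comp_homeomorph (Homeomorph.subLeft θ)
  have hcs : HasCompactSupport fun y => q (‖y‖ ^ 2) • f (θ - y) :=
    hc'.smul_left (f := fun y => q (‖y‖ ^ 2))
  have h1 : ∫ y, q (‖θ - y‖ ^ 2) • f y = ∫ y, q (‖y‖ ^ 2) • f (θ - y) := by
    rw [← integral_sub_left_eq_self (fun y => q (‖θ - y‖ ^ 2) • f y) volume θ]
    simp
  rw [h1, integral_eq_integral_Ioi_integral_sphere _
    (hcont.integrable_of_hasCompactSupport hcs), ← integral_smul]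
  refine setIntegral_congr_fun measurableSet_Ioi fun t ht => ?_
  have ht : 0 < t := ht
  have hσ := (sphereArea_pos (n := n) (by omega)).ne'
  simp only [norm_smul, Real.norm_of_nonneg ht.le, norm_eq_of_mem_sphere, mul_one,
    finrank_euclideanSpace, Fintype.card_fin, sphericalMean, sphereMeasure]
  rw [integral_smul, smul_smul, smul_smul, smul_smul]
  congr 1
  field_simp

/-- The substitution `s = t²` brings in the integration by parts above; `ρ < η` kills the boundary
terms and `η < c` keeps `t` away from 0. -/
theorem integral_smul_filteredMean_sqrt (hn : 3 ≤ n) (hf : ContDiff ℝ ∞ f)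
    (hc : HasCompactSupport f) (θ : EuclideanSpace ℝ (Fin n)) {ψ : ℝ → ℝ}
    (hψ : ContDiff ℝ ∞ ψ) {ρ η c : ℝ} (hρ0 : 0 ≤ ρ) (hρ : ρ < η) (hη : η < c)
    (hsupp : ∀ s, ρ < |s| → ψ s = 0) :
    ∫ s in (c - η)..(c + η), ψ (s - c) • filteredMean f θ √s =
      ((-1) ^ (n - 3) * (2 / sphereArea n)) •
        ∫ y, iteratedDeriv (n - 3) ψ (‖θ - y‖ ^ 2 - c) • f y := by
  set a := √(c - η) with ha_def
  set b := √(c + η) with hb_def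
  have ha : 0 < a := Real.sqrt_pos.2 (by linarith)
  have hab : a ≤ b := Real.sqrt_le_sqrt (by linarith)
  have ha2 : a ^ 2 = c - η := Real.sq_sqrt (by linarith)
  have hb2 : b ^ 2 = c + η := Real.sq_sqrt (by linarith)
  have hψc : ContDiff ℝ ∞ fun s => ψ (s - c) := by fun_prop
  have hder : ∀ j s, iteratedDeriv j (fun s => ψ (s - c)) s = iteratedDeriv j ψ (s - c) := by
    intro j s
    rw [iteratedDeriv_comp_sub_const]
  have hvan := iteratedDeriv_eq_zero_of_lt_abs hsupp
  have hψa : ∀ j, iteratedDeriv j (fun s => ψ (s - c)) (a ^ 2) = 0 := by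
    intro j
    rw [hder, ha2]
    refine hvan j _ ?_
    rw [sub_sub_cancel_left, abs_neg]
    exact hρ.trans_le (le_abs_self η)
  have hψb : ∀ j, iteratedDeriv j (fun s => ψ (s - c)) (b ^ 2) = 0 := by
    intro j
    rw [hder, hb2]
    refine hvan j _ ?_
    rw [add_sub_cancel_left]
    exact hρ.trans_le (le_abs_self η)
  have hmean := contDiff_sphericalMean_right hf θ
  have hg : ContDiffOn ℝ ∞ (fun t : ℝ => t ^ (n - 2) • sphericalMean f θ t) (Ioi 0) :=
    ((contDiff_id.pow _).smul hmean).contDiffOn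
  have hfm : ContinuousOn (filteredMean f θ) (Ioi 0) :=
    (contDiffOn_iterate_opD_real hg (n - 3)).continuousOn
  have hibp := integral_iteratedDeriv_comp_sq_smul_iterate_opD hg hψc ha hab hψa hψb (n - 3) 0
  have hsubst : ∫ t in a..b, (2 * t * iteratedDeriv 0 (fun s => ψ (s - c)) (t ^ 2)) •
      opD^[n - 3] (fun t : ℝ => t ^ (n - 2) • sphericalMean f θ t) t =
      ∫ s in (c - η)..(c + η), ψ (s - c) • filteredMean f θ √s := by
    rw [← ha2, ← hb2]
    have hpos : ∀ t ∈ uIcc a b, 0 < t := fun t ht => by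
      rw [uIcc_of_le hab] at ht
      exact ha.trans_le ht.1
    have h := intervalIntegral.integral_deriv_smul_comp'' (a := a) (b := b)
      (f := fun t => t ^ 2) (f' := fun t => 2 * t)
      (g := fun s => ψ (s - c) • filteredMean f θ √s) (by fun_prop)
      (fun t _ => by simpa using (hasDerivAt_pow 2 t).hasDerivWithinAt) (by fun_prop) ?_
    · rw [← h]
      refine intervalIntegral.integral_congr fun t ht => ?_
      simp [Real.sqrt_sq (hpos t ht).le, smul_smul, filteredMean]
    · refine ContinuousOn.smul hψc.continuous.continuousOn (hfm.comp (by fun_prop) ?_)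
      rintro _ ⟨t, ht, rfl⟩
      have := hpos t ht
      exact Real.sqrt_pos.2 (by positivity)
  have hq : Continuous fun s => iteratedDeriv (n - 3) ψ (s - c) :=
    (hψ.continuous_iteratedDeriv _ (WithTop.coe_le_coe.2 le_top)).comp (by fun_prop)
  have hpolar := integral_comp_norm_sq_smul_eq_integral_sphericalMean (by omega)
    hf.continuous hc hq θ
  have hσ := (sphereArea_pos (n := n) (by omega)).ne'
  -- The weight `t^{n-2}` times the Jacobian `2t` is twice the polar density `t^{n-1}`, and outside
  -- `(a, b]` the derivative of `ψ` vanishes.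
  have hrange : ∫ t in a..b, (2 * t * iteratedDeriv (0 + (n - 3)) (fun s => ψ (s - c)) (t ^ 2)) •
      t ^ (n - 2) • sphericalMean f θ t =
      (2 : ℝ) • ∫ t in Ioi (0 : ℝ), (iteratedDeriv (n - 3) ψ (t ^ 2 - c) * t ^ (n - 1)) •
        sphericalMean f θ t := by
    rw [← integral_smul, intervalIntegral.integral_of_le hab, ← integral_indicator measurableSet_Ioc,
      ← integral_indicator measurableSet_Ioi]
    refine integral_congr_ae (Filter.Eventually.of_forall fun t => ?_)
    have hpow : t ^ (n - 1) = t * t ^ (n - 2) := by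
      rw [← pow_succ']
      congr 1
      omega
    by_cases ht : t ∈ Ioc a b
    · have ht0 : t ∈ Ioi (0 : ℝ) := ha.trans ht.1
      simp only [indicator_of_mem ht, indicator_of_mem ht0, hder, zero_add, smul_smul, hpow]
      congr 1
      ring
    · rw [indicator_of_notMem ht]
      by_cases ht0 : t ∈ Ioi (0 : ℝ)
      · rw [indicator_of_mem ht0, hvan (n - 3) (t ^ 2 - c)]
        · simp
        · refine hρ.trans_le ?_
          have ht0 : 0 < t := ht0
          rw [mem_Ioc, not_and_or, not_lt, not_le] at ht
          rcases ht with ht | ht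
          · rw [le_abs]
            right
            nlinarith
          · rw [le_abs]
            left
            nlinarith
      · rw [indicator_of_notMem ht0]
  rw [hsubst, hrange] at hibp
  rw [hibp, hpolar, smul_smul, smul_smul]
  congr 1
  field_simp

end SphericalMeans

/-! ### The mollified back-projection and its kernel. -/

section BackProjection

open Filter Topology

variable {𝕜 : Type*} [RCLike 𝕜]

theorem one_sub_norm_sq_le_norm_sub_sq {E : Type*} [NormedAddCommGroup E] {x : E}
    (hx : ‖x‖ < 1) (θ : sphere (0 : E) 1) : (1 - ‖x‖) ^ 2 ≤ ‖x - θ‖ ^ 2 := by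
  have h1 : ‖(θ : E)‖ = 1 := norm_eq_of_mem_sphere θ
  have h2 := norm_sub_norm_le (θ : E) x
  rw [h1, norm_sub_rev] at h2
  exact pow_le_pow_left₀ (by linarith) h2 2

theorem tendsto_integral_sphere_integral_smul {n : ℕ} {G : EuclideanSpace ℝ (Fin n) × ℝ → 𝕜}
    (hG : ContinuousOn G (univ ×ˢ Ioi 0)) {χ : ℝ → ℝ} (hχ : Continuous χ)
    {x : EuclideanSpace ℝ (Fin n)} (hx : ‖x‖ < 1) :
    Tendsto (fun η : ℝ => ∫ θ : sphere (0 : EuclideanSpace ℝ (Fin n)) 1,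
      (∫ u in (-1 : ℝ)..1, χ u • G (θ, √(η * u + ‖x - θ‖ ^ 2))) ∂(sphereMeasure n)) (𝓝[>] 0)
      (𝓝 (∫ θ : sphere (0 : EuclideanSpace ℝ (Fin n)) 1,
        (∫ u in (-1 : ℝ)..1, χ u) • G (θ, ‖x - θ‖) ∂(sphereMeasure n))) := by
  unfold sphereMeasure
  set S := sphere (0 : EuclideanSpace ℝ (Fin n)) 1
  set δ : ℝ := (1 - ‖x‖) ^ 2 / 2 with hδ
  have hr : 0 < 1 - ‖x‖ := by linarith
  have hδ0 : 0 < δ := by positivity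
  have hc : ∀ θ : S, 2 * δ ≤ ‖x - θ‖ ^ 2 := fun θ => by
    have := one_sub_norm_sq_le_norm_sub_sq hx θ
    linarith
  -- Truncating at `δ` keeps the radius positive, so `H` is continuous for all `η` and continuity
  -- gives the limit. Since `|x - θ|² ≥ 2δ`, the truncation is inactive for `0 ≤ η < δ`.
  let H : (ℝ × S) → ℝ → 𝕜 := fun p u =>
    χ u • G (p.2, √(max (p.1 * u + ‖x - p.2‖ ^ 2) δ))
  have hH : Continuous (Function.uncurry H) := by
    refine Continuous.smul (by fun_prop) (hG.comp_continuous (by fun_prop) fun q => ?_)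
    exact ⟨mem_univ _, Real.sqrt_pos.2 (lt_max_of_lt_right hδ0)⟩
  have h1 : Continuous fun p : ℝ × S => ∫ u in (-1 : ℝ)..1, H p u :=
    intervalIntegral.continuous_parametric_intervalIntegral_of_continuous' hH (-1) 1
  have h2 : Continuous fun η : ℝ => ∫ θ : S, (∫ u in (-1 : ℝ)..1, H (η, θ) u)
      ∂(volume : Measure (EuclideanSpace ℝ (Fin n))).toSphere := by
    have h := continuous_parametric_integral_of_continuous
      (μ := (volume : Measure (EuclideanSpace ℝ (Fin n))).toSphere)
      (f := fun (η : ℝ) (θ : S) => ∫ u in (-1 : ℝ)..1, H (η, θ) u) h1 isCompact_univ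
    simpa using h
  have h3 := (h2.tendsto 0).mono_left (nhdsWithin_le_nhds (s := Ioi 0))
  have h4 : (∫ θ : S, (∫ u in (-1 : ℝ)..1, H (0, θ) u)
      ∂(volume : Measure (EuclideanSpace ℝ (Fin n))).toSphere) =
      ∫ θ : S, (∫ u in (-1 : ℝ)..1, χ u) • G (θ, ‖x - θ‖)
        ∂(volume : Measure (EuclideanSpace ℝ (Fin n))).toSphere := by
    refine integral_congr_ae (Eventually.of_forall fun θ => ?_)
    simp only [H, zero_mul, zero_add]
    rw [max_eq_left (by linarith [hc θ]), Real.sqrt_sq (norm_nonneg _),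
      intervalIntegral.integral_smul_const]
  rw [h4] at h3
  refine h3.congr' ?_
  filter_upwards [Ioo_mem_nhdsGT hδ0] with η hη
  refine integral_congr_ae (Eventually.of_forall fun θ => ?_)
  refine intervalIntegral.integral_congr fun u hu => ?_
  rw [uIcc_of_le (by norm_num)] at hu
  have : -η ≤ η * u := by nlinarith [hu.1, hη.1]
  simp only [H]
  rw [max_eq_left (by linarith [hc θ, hη.2])]

/-- The average over the unit sphere of the rescaled derivative of a bump function that arises as
the kernel of the mollified back-projection. -/
noncomputable def sphereKernel (n : ℕ) (χ : ℝ → ℝ) (η : ℝ) (x y : EuclideanSpace ℝ (Fin n)) : ℝ :=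
  ∫ θ : sphere (0 : EuclideanSpace ℝ (Fin n)) 1,
    iteratedDeriv (n - 3) (fun s => χ (s / η)) (‖θ - y‖ ^ 2 - ‖x - θ‖ ^ 2) ∂(sphereMeasure n)

theorem iteratedDeriv_comp_div {χ : ℝ → ℝ} (hχ : ContDiff ℝ ∞ χ) (k : ℕ) (η s : ℝ) :
    iteratedDeriv k (fun s => χ (s / η)) s = (η ^ k)⁻¹ * iteratedDeriv k χ (s / η) := by
  have h : (fun s => χ (s / η)) = fun s => χ (η⁻¹ * s) := by
    ext s
    rw [div_eq_inv_mul]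
  rw [h, iteratedDeriv_comp_const_mul (hχ.of_le (WithTop.coe_le_coe.2 le_top))]
  simp [div_eq_inv_mul]

theorem abs_sphereKernel_le {n : ℕ} {χ : ℝ → ℝ} (hχ : ContDiff ℝ ∞ χ) {B : ℝ}
    (hB : ∀ s, |iteratedDeriv (n - 3) χ s| ≤ B) {η : ℝ} (hη : 0 < η)
    (x y : EuclideanSpace ℝ (Fin n)) :
    |sphereKernel n χ η x y| ≤ (η ^ (n - 3))⁻¹ * B * (sphereMeasure n).real univ := by
  rw [← Real.norm_eq_abs]
  have : IsFiniteMeasure (sphereMeasure n) := by unfold sphereMeasure; infer_instance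
  refine norm_integral_le_of_norm_le_const (Eventually.of_forall fun θ => ?_)
  rw [iteratedDeriv_comp_div hχ, norm_mul, Real.norm_of_nonneg (by positivity), Real.norm_eq_abs]
  gcongr
  exact hB _

/-- The term `‖θ‖²` cancels, leaving an affine function of `θ`: spherical data become plane waves.
-/
theorem norm_sub_sq_sub_norm_sub_sq {E : Type*} [NormedAddCommGroup E] [InnerProductSpace ℝ E]
    (x y θ : E) :
    ‖θ - y‖ ^ 2 - ‖x - θ‖ ^ 2 = ‖y‖ ^ 2 - ‖x‖ ^ 2 + inner ℝ ((2 : ℝ) • (x - y)) θ := by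
  rw [norm_sub_sq_real, norm_sub_sq_real, inner_smul_left, inner_sub_left, real_inner_comm θ y]
  simp
  ring

theorem abs_norm_sq_sub_norm_sq_le {E : Type*} [NormedAddCommGroup E] {x y : E}
    (hy : ‖y‖ ≤ 1) : |‖y‖ ^ 2 - ‖x‖ ^ 2| ≤ ‖x - y‖ * (1 + ‖x‖) := by
  have h1 : |‖y‖ - ‖x‖| ≤ ‖x - y‖ := by
    rw [norm_sub_rev]
    exact abs_norm_sub_norm_le y x
  rw [sq_sub_sq, abs_mul, abs_of_nonneg (by positivity), mul_comm]
  gcongr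

/-- The plane wave formula applies with `c = ‖y‖² - ‖x‖²` and `v = 2(x - y)`: `|c| ≤ ‖x - y‖(1 +
‖x‖)`, so the bound on `η` leaves `|c| + η/2 < ‖v‖`. -/
theorem sphereKernel_eq (m : ℕ) {χ : ℝ → ℝ} (hχ : ContDiff ℝ ∞ χ)
    (hsupp : ∀ s, 1 / 2 < |s| → χ s = 0) {η : ℝ} (hη : 0 < η)
    {x y : EuclideanSpace ℝ (Fin (2 * (m + 1) + 1))} (hy : ‖y‖ ≤ 1)
    (hxy : η < ‖x - y‖ * (1 - ‖x‖)) :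
    sphereKernel _ χ η x y =
      planeWaveConst m * (‖(2 : ℝ) • (x - y)‖ ^ (2 * m + 1))⁻¹ * (η * ∫ s, χ s) := by
  unfold sphereKernel
  simp only [norm_sub_sq_sub_norm_sub_sq]
  have hk : 2 * (m + 1) + 1 - 3 = 2 * m := by omega
  rw [hk, integral_sphere_iteratedDeriv_comp_inner m (η := η / 2)
    (ψ := fun s => χ (s / η)) (hχ.comp (by fun_prop)) (by positivity) ?_ ?_]
  · rw [Measure.integral_comp_div, abs_of_pos hη, smul_eq_mul]
  · intro s hs
    apply hsupp
    rw [abs_div, abs_of_pos hη, lt_div_iff₀ hη]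
    linarith
  · have h1 := abs_norm_sq_sub_norm_sq_le (x := x) hy
    rw [norm_smul, Real.norm_ofNat]
    linarith

end BackProjection

/-! ### The limit of vanishing width and the inversion formula. -/

section BackProjection

open Filter Topology
open scoped Convolution

variable {𝕜 : Type*} [RCLike 𝕜]

/-- Fubini, after rescaling `s = ηu + ‖x - θ‖²`. Oddness of `n` removes the sign `(-1)^{n-3}`, and
the bound on `η` keeps `s` positive for every `θ`. -/
theorem integral_sphereKernel_smul {n : ℕ} (hn : 3 ≤ n) (hodd : Odd n)
    {f : EuclideanSpace ℝ (Fin n) → 𝕜} (hf : ContDiff ℝ ∞ f) (hc : HasCompactSupport f)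
    {χ : ℝ → ℝ} (hχ : ContDiff ℝ ∞ χ) (hsupp : ∀ s, 1 / 2 < |s| → χ s = 0)
    {x : EuclideanSpace ℝ (Fin n)} (hx : ‖x‖ < 1) {η : ℝ} (hη : 0 < η)
    (hηx : η < (1 - ‖x‖) ^ 2) :
    ∫ θ : sphere (0 : EuclideanSpace ℝ (Fin n)) 1,
      (∫ u in (-1 : ℝ)..1, χ u • filteredMean f (θ : EuclideanSpace ℝ (Fin n))
        √(η * u + ‖x - θ‖ ^ 2)) ∂(sphereMeasure n) =
      (2 / sphereArea n) • ∫ y, (η⁻¹ * sphereKernel n χ η x y) • f y := by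
  have hfin : IsFiniteMeasure (sphereMeasure n) := by unfold sphereMeasure; infer_instance
  let ψ : ℝ → ℝ := fun s => χ (s / η)
  have hψ : ContDiff ℝ ∞ ψ := hχ.comp (by fun_prop)
  have hψc : Continuous (iteratedDeriv (n - 3) ψ) :=
    hψ.continuous_iteratedDeriv _ (WithTop.coe_le_coe.2 le_top)
  have hψs : ∀ s, η / 2 < |s| → ψ s = 0 := by
    intro s hs
    apply hsupp
    rw [abs_div, abs_of_pos hη, lt_div_iff₀ hη]
    linarith
  have heven : (-1 : ℝ) ^ (n - 3) = 1 := Even.neg_one_pow (by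
    obtain ⟨k, rfl⟩ := hodd
    exact ⟨k - 1, by omega⟩)
  have hθ : ∀ θ : sphere (0 : EuclideanSpace ℝ (Fin n)) 1,
      ∫ u in (-1 : ℝ)..1, χ u • filteredMean f (θ : EuclideanSpace ℝ (Fin n))
        √(η * u + ‖x - θ‖ ^ 2) = (2 / sphereArea n) • ∫ y : EuclideanSpace ℝ (Fin n),
          (η⁻¹ * iteratedDeriv (n - 3) ψ (‖θ - y‖ ^ 2 - ‖x - θ‖ ^ 2)) • f y := by
    intro θ
    have h1 := integral_smul_filteredMean_sqrt hn hf hc (θ : EuclideanSpace ℝ (Fin n)) hψ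
      (ρ := η / 2) (η := η) (c := ‖x - θ‖ ^ 2) (by positivity) (by linarith)
      (hηx.trans_le (one_sub_norm_sq_le_norm_sub_sq hx θ)) hψs
    have h2 := intervalIntegral.smul_integral_comp_mul_add (a := -1) (b := 1)
      (fun s => ψ (s - ‖x - θ‖ ^ 2) • filteredMean f (θ : EuclideanSpace ℝ (Fin n)) √s)
      η (‖x - θ‖ ^ 2)
    have h3 : η * (-1) + ‖x - θ‖ ^ 2 = ‖x - θ‖ ^ 2 - η := by ring
    have h4 : η * 1 + ‖x - θ‖ ^ 2 = ‖x - θ‖ ^ 2 + η := by ring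
    rw [h3, h4, h1, heven, one_mul] at h2
    simp only [add_sub_cancel_right, ψ, mul_div_cancel_left₀ _ hη.ne'] at h2
    rw [← inv_smul_smul₀ hη.ne' (∫ u in (-1 : ℝ)..1, _), h2, smul_comm, ← integral_smul]
    simp only [smul_smul, ψ]
  simp only [hθ]
  rw [integral_smul]
  congr 1
  have hF : Continuous (Function.uncurry fun
      (θ : sphere (0 : EuclideanSpace ℝ (Fin n)) 1) (y : EuclideanSpace ℝ (Fin n)) =>
      (η⁻¹ * iteratedDeriv (n - 3) ψ (‖θ - y‖ ^ 2 - ‖x - θ‖ ^ 2)) • f y) := by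
    have := hf.continuous
    fun_prop
  have hFc : HasCompactSupport (Function.uncurry fun
      (θ : sphere (0 : EuclideanSpace ℝ (Fin n)) 1) (y : EuclideanSpace ℝ (Fin n)) =>
      (η⁻¹ * iteratedDeriv (n - 3) ψ (‖θ - y‖ ^ 2 - ‖x - θ‖ ^ 2)) • f y) := by
    refine HasCompactSupport.intro
      ((isCompact_univ (X := sphere (0 : EuclideanSpace ℝ (Fin n)) 1)).prod hc) fun p hp => ?_
    have : f p.2 = 0 := image_eq_zero_of_notMem_tsupport fun h => hp ⟨mem_univ _, h⟩
    simp [Function.uncurry, this]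
  rw [integral_integral_swap_of_hasCompactSupport hF hFc]
  refine integral_congr_ae (Eventually.of_forall fun y => ?_)
  simp only [sphereKernel]
  rw [integral_smul_const, integral_const_mul]

/-- For fixed `y ≠ x` with `f y ≠ 0`, the integrand is eventually constant in `η`, so only
domination matters; a multiple of `‖x - y‖^{-(2m+1)} ‖f y‖` dominates, integrable since `2m + 1 <
n`. -/
theorem tendsto_integral_sphereKernel_smul (m : ℕ)
    {f : EuclideanSpace ℝ (Fin (2 * (m + 1) + 1)) → 𝕜} (hf : Continuous f)
    (hsf : tsupport f ⊆ ball 0 1) (hc : HasCompactSupport f)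
    {χ : ℝ → ℝ} (hχ : ContDiff ℝ ∞ χ) (hsupp : ∀ s, 1 / 2 < |s| → χ s = 0)
    {x : EuclideanSpace ℝ (Fin (2 * (m + 1) + 1))} (hx : ‖x‖ < 1) :
    Tendsto (fun η : ℝ => ∫ y, (η⁻¹ * sphereKernel _ χ η x y) • f y) (𝓝[>] 0)
      (𝓝 (∫ y, (planeWaveConst m * (‖(2 : ℝ) • (x - y)‖ ^ (2 * m + 1))⁻¹ * ∫ s, χ s) • f y)) := by
  have hr : 0 < 1 - ‖x‖ := by linarith
  have hk : 2 * (m + 1) + 1 - 3 = 2 * m := by omega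
  have hχc : HasCompactSupport (iteratedDeriv (2 * (m + 1) + 1 - 3) χ) := by
    refine HasCompactSupport.intro (isCompact_Icc (a := (-1 / 2 : ℝ)) (b := 1 / 2)) fun s hs => ?_
    refine iteratedDeriv_eq_zero_of_lt_abs hsupp _ s ?_
    by_contra h
    have := abs_le.1 (not_lt.1 h)
    exact hs ⟨by linarith, this.2⟩
  obtain ⟨B, hB⟩ : ∃ B, ∀ s, |iteratedDeriv (2 * (m + 1) + 1 - 3) χ s| ≤ B :=
    hχc.exists_bound_of_continuous
      (hχ.continuous_iteratedDeriv _ (WithTop.coe_le_coe.2 le_top))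
  have hB0 : 0 ≤ B := (abs_nonneg _).trans (hB 0)
  set M := (sphereMeasure (2 * (m + 1) + 1)).real univ
  have hM : 0 ≤ M := measureReal_nonneg
  let C : ℝ := |planeWaveConst m| * (2 ^ (2 * m + 1))⁻¹ * |∫ s, χ s| +
    B * M * ((1 - ‖x‖) ^ (2 * m + 1))⁻¹
  have hf0 : ∀ y, f y ≠ 0 → ‖y‖ ≤ 1 := fun y hy =>
    (mem_ball_zero_iff.1 (hsf (subset_tsupport f hy))).le
  have hne : ∀ᵐ y : EuclideanSpace ℝ (Fin (2 * (m + 1) + 1)), y ≠ x := by simp [ae_iff]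
  have hint : Integrable fun y => C * ‖(‖x - y‖ ^ (2 * m + 1))⁻¹ • f y‖ := by
    have hc' : HasCompactSupport fun y => f (x - y) := hc.comp_homeomorph (Homeomorph.subLeft x)
    have h1 := integrable_norm_pow_inv_smul (k := 2 * m + 1)
      (E := EuclideanSpace ℝ (Fin (2 * (m + 1) + 1))) (by simp)
      (h := fun y => f (x - y)) (by fun_prop) hc'
    have h2 := h1.comp_sub_left x
    simp only [sub_sub_cancel] at h2
    exact h2.norm.const_mul C
  refine tendsto_integral_filter_of_dominated_convergence _ ?_ ?_ hint ?_
  · refine Eventually.of_forall fun η => ?_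
    refine Continuous.aestronglyMeasurable (Continuous.smul (continuous_const.mul ?_) hf)
    have hcont : Continuous (iteratedDeriv (2 * (m + 1) + 1 - 3) fun s => χ (s / η)) :=
      ContDiff.continuous_iteratedDeriv (n := ∞) _
        (hχ.comp (by fun_prop)) (WithTop.coe_le_coe.2 le_top)
    have h := continuous_parametric_integral_of_continuous
      (μ := (volume : Measure (EuclideanSpace ℝ (Fin (2 * (m + 1) + 1)))).toSphere)
      (f := fun (y : EuclideanSpace ℝ (Fin (2 * (m + 1) + 1))) (θ : sphere (0 :
        EuclideanSpace ℝ (Fin (2 * (m + 1) + 1))) 1) =>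
          iteratedDeriv (2 * (m + 1) + 1 - 3) (fun s => χ (s / η))
            (‖θ - y‖ ^ 2 - ‖x - θ‖ ^ 2)) (by fun_prop) isCompact_univ
    simp only [Measure.restrict_univ] at h
    exact h
  · filter_upwards [self_mem_nhdsWithin] with η hη
    have hη : 0 < η := hη
    filter_upwards [hne] with y hy
    by_cases hfy : f y = 0
    · simp [hfy]
    have hxy : 0 < ‖x - y‖ := norm_sub_pos_iff.2 hy.symm
    rw [norm_smul, norm_smul, ← mul_assoc]
    gcongr ?_ * _
    rw [Real.norm_eq_abs, Real.norm_eq_abs, abs_mul, abs_of_pos (inv_pos.2 hη),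
      abs_of_nonneg (a := (‖x - y‖ ^ (2 * m + 1))⁻¹) (by positivity)]
    -- Away from the diagonal the kernel is explicit. Near it, the sup bound gives `η^{-(2m+1)}` in
    -- total, and `η ≥ ‖x - y‖(1 - ‖x‖)` turns this into the required power of `‖x - y‖`.
    by_cases hcase : η < ‖x - y‖ * (1 - ‖x‖)
    · rw [sphereKernel_eq m hχ hsupp hη (hf0 y hfy) hcase, norm_smul, Real.norm_ofNat, mul_pow,
        mul_inv]
      simp only [abs_mul, abs_inv, abs_of_pos hη, abs_pow, abs_norm, Nat.abs_ofNat]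
      have : η⁻¹ * (|planeWaveConst m| * ((2 ^ (2 * m + 1))⁻¹ * (‖x - y‖ ^ (2 * m + 1))⁻¹) *
          (η * |∫ s, χ s|)) = |planeWaveConst m| * (2 ^ (2 * m + 1))⁻¹ * |∫ s, χ s| *
            (‖x - y‖ ^ (2 * m + 1))⁻¹ := by field_simp
      rw [this]
      gcongr
      exact le_add_of_nonneg_right (by positivity)
    · rw [not_lt] at hcase
      have h1 := abs_sphereKernel_le hχ hB hη x y
      rw [hk] at h1
      calc η⁻¹ * |sphereKernel _ χ η x y| ≤ η⁻¹ * ((η ^ (2 * m))⁻¹ * B * M) := by gcongr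
        _ = B * M * (η ^ (2 * m + 1))⁻¹ := by rw [pow_succ]; field_simp
        _ ≤ B * M * ((‖x - y‖ * (1 - ‖x‖)) ^ (2 * m + 1))⁻¹ := by gcongr
        _ = B * M * ((1 - ‖x‖) ^ (2 * m + 1))⁻¹ * (‖x - y‖ ^ (2 * m + 1))⁻¹ := by
          rw [mul_pow, mul_inv]
          ring
        _ ≤ C * (‖x - y‖ ^ (2 * m + 1))⁻¹ := by
          gcongr
          exact le_add_of_nonneg_left (by positivity)
  · filter_upwards [hne] with y hy
    by_cases hfy : f y = 0
    · simp [hfy]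
    have hxy : 0 < ‖x - y‖ * (1 - ‖x‖) := mul_pos (norm_sub_pos_iff.2 hy.symm) hr
    refine tendsto_nhds_of_eventually_eq ?_
    filter_upwards [Ioo_mem_nhdsGT hxy] with η hη
    rw [sphereKernel_eq m hχ hsupp hη.1 (hf0 y hfy) hη.2]
    congr 1
    have := hη.1.ne'
    field_simp

theorem exists_contDiff_integral_eq_one : ∃ χ : ℝ → ℝ, ContDiff ℝ ∞ χ ∧
    (∀ s, 1 / 2 < |s| → χ s = 0) ∧ ∫ s, χ s = 1 := by
  let φ : ContDiffBump (0 : ℝ) := ⟨1 / 4, 1 / 2, by norm_num, by norm_num⟩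
  refine ⟨φ.normed volume, φ.contDiff_normed, fun s hs => ?_, φ.integral_normed⟩
  have : s ∉ Function.support (φ.normed volume) := by
    rw [φ.support_normed_eq, mem_ball_zero_iff, Real.norm_eq_abs]
    exact not_lt.2 hs.le
  simpa using this

/-- Two limits of the same mollified quantity: continuity of the filtered data gives the left side,
convergence of the kernels the right. -/
theorem backProjection_eq_newtonianPotential (m : ℕ)
    {f : EuclideanSpace ℝ (Fin (2 * (m + 1) + 1)) → 𝕜} (hf : ContDiff ℝ ∞ f)
    (hsf : tsupport f ⊆ ball 0 1) (hc : HasCompactSupport f)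
    {x : EuclideanSpace ℝ (Fin (2 * (m + 1) + 1))} (hx : ‖x‖ < 1) :
    backProjection f x =
      (2 / sphereArea (2 * (m + 1) + 1) * (planeWaveConst m / 2 ^ (2 * m + 1))) •
        ((fun z : EuclideanSpace ℝ (Fin (2 * (m + 1) + 1)) => (‖z‖ ^ (2 * (m + 1) + 1 - 2))⁻¹)
          ⋆[ContinuousLinearMap.lsmul ℝ ℝ] f) x := by
  obtain ⟨χ, hχ, hsupp, hχ1⟩ := exists_contDiff_integral_eq_one
  have hχi : ∫ u in (-1 : ℝ)..1, χ u = 1 := by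
    rw [intervalIntegral.integral_eq_integral_of_support_subset, hχ1]
    intro s hs
    by_contra h
    refine hs (hsupp s ?_)
    by_contra h'
    have := abs_le.1 (not_lt.1 h')
    exact h ⟨by linarith, by linarith⟩
  have hr : 0 < (1 - ‖x‖) ^ 2 := by
    have : 0 < 1 - ‖x‖ := by linarith
    positivity
  have h1 := tendsto_integral_sphere_integral_smul (contDiffOn_filteredMean hf).continuousOn
    hχ.continuous hx
  have h2 := (tendsto_integral_sphereKernel_smul m hf.continuous hsf hc hχ hsupp hx).const_smul
    (2 / sphereArea (2 * (m + 1) + 1))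
  have h3 := tendsto_nhds_unique (h1.congr' (by
    filter_upwards [Ioo_mem_nhdsGT hr] with η hη
    exact integral_sphereKernel_smul (by omega) ⟨m + 1, rfl⟩ hf hc hχ hsupp hx hη.1 hη.2)) h2
  simp only [hχi, one_smul, hχ1, mul_one] at h3
  have hk : 2 * (m + 1) + 1 - 2 = 2 * m + 1 := by omega
  rw [backProjection, h3, mul_smul, convolution_lsmul_swap, hk]
  congr 1
  rw [← integral_smul]
  refine integral_congr_ae (Eventually.of_forall fun y => ?_)
  simp only [smul_smul, norm_smul, Real.norm_ofNat, mul_pow, mul_inv]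
  congr 1
  ring

theorem integrable_filteredMean {n : ℕ} {f : EuclideanSpace ℝ (Fin n) → 𝕜}
    (hf : ContDiff ℝ ∞ f) {x : EuclideanSpace ℝ (Fin n)} (hx : ‖x‖ < 1) :
    Integrable (fun θ : sphere (0 : EuclideanSpace ℝ (Fin n)) 1 =>
      filteredMean f (θ : EuclideanSpace ℝ (Fin n)) ‖x - θ‖) (sphereMeasure n) := by
  have : IsFiniteMeasure (sphereMeasure n) := by unfold sphereMeasure; infer_instance
  refine Continuous.integrable_of_hasCompactSupport ?_ (HasCompactSupport.of_compactSpace _)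
  refine (contDiffOn_filteredMean hf).continuousOn.comp_continuous
    (f := fun θ : sphere (0 : EuclideanSpace ℝ (Fin n)) 1 =>
      ((θ : EuclideanSpace ℝ (Fin n)), ‖x - θ‖)) (by fun_prop) fun θ => ⟨mem_univ _, ?_⟩
  have h1 := one_sub_norm_sq_le_norm_sub_sq hx θ
  refine (norm_nonneg _).lt_of_ne fun h => ?_
  rw [← h] at h1
  nlinarith

end BackProjection

theorem mainTheorem1 {𝕜 : Type*} [RCLike 𝕜] (n : ℕ) (hn : Odd n) (hn3 : 3 ≤ n)
    (f : EuclideanSpace ℝ (Fin n) → 𝕜) (hf : ContDiff ℝ ∞ f)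
    (hsupp : tsupport f ⊆ ball (0 : EuclideanSpace ℝ (Fin n)) 1) :
    (∀ θ : sphere (0 : EuclideanSpace ℝ (Fin n)) 1,
      ContDiffOn ℝ ∞ (sphericalMean f (θ : EuclideanSpace ℝ (Fin n))) (Ioi 0)) ∧
    (∀ x ∈ ball (0 : EuclideanSpace ℝ (Fin n)) 1,
      Integrable (fun θ : sphere (0 : EuclideanSpace ℝ (Fin n)) 1 =>
        filteredMean f (θ : EuclideanSpace ℝ (Fin n))
          ‖x - (θ : EuclideanSpace ℝ (Fin n))‖) (sphereMeasure n)) ∧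
    ContDiffOn ℝ 2 (backProjection f) (ball (0 : EuclideanSpace ℝ (Fin n)) 1) ∧
    ∀ x ∈ ball (0 : EuclideanSpace ℝ (Fin n)) 1,
      f x = inversionConst n • Laplacian.laplacian (backProjection f) x := by
  have hc : HasCompactSupport f :=
    (isCompact_closedBall _ _).of_isClosed_subset (isClosed_tsupport f)
      (hsupp.trans ball_subset_closedBall)
  obtain ⟨m, rfl⟩ : ∃ m, n = 2 * (m + 1) + 1 := by
    obtain ⟨k, rfl⟩ := hn
    exact ⟨k - 1, by omega⟩
  have hu := (contDiff_newtonianPotential hn3 (by simp) hf hc).of_le (m := 2)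
    (WithTop.coe_le_coe.2 (le_top : (2 : ℕ∞) ≤ ⊤))
  refine ⟨fun θ => (contDiff_sphericalMean_right hf θ).contDiffOn,
    fun x hx => integrable_filteredMean hf (mem_ball_zero_iff.1 hx), ?_, fun x hx => ?_⟩
  · refine ContDiffOn.congr ?_ fun x hx =>
      backProjection_eq_newtonianPotential m hf hsupp hc (mem_ball_zero_iff.1 hx)
    exact (hu.const_smul _).contDiffOn
  -- The identity with the potential is available only inside the ball; as the ball is open, it
  -- holds near `x`, which suffices for the Laplacian.
  · have heq : backProjection f =ᶠ[nhds x]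
        (2 / sphereArea (2 * (m + 1) + 1) * (planeWaveConst m / 2 ^ (2 * m + 1))) •
          convolution (fun z : EuclideanSpace ℝ (Fin (2 * (m + 1) + 1)) =>
            (‖z‖ ^ (2 * (m + 1) + 1 - 2))⁻¹) f (ContinuousLinearMap.lsmul ℝ ℝ) volume := by
      filter_upwards [isOpen_ball.mem_nhds hx] with y hy
      exact backProjection_eq_newtonianPotential m hf hsupp hc (mem_ball_zero_iff.1 hy)
    rw [(InnerProductSpace.laplacian_congr_nhds heq).self_of_nhds]
    rw [InnerProductSpace.laplacian_smul _ hu.contDiffAt,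
      laplacian_newtonianPotential hn3 (by simp) hf hc, smul_smul, smul_smul]
    have hσ := (sphereArea_pos (n := 2 * (m + 1) + 1) (by omega)).ne'
    have hconst := inversionConst_mul_planeWaveConst m
    -- Writing the sphere area as `n v` cancels the factor `n v` from the Laplacian of the
    -- potential, leaving `n - 2 = 2m + 1`.
    rw [sphereArea_eq (by omega)] at hσ ⊢
    set v := volume.real (ball (0 : EuclideanSpace ℝ (Fin (2 * (m + 1) + 1))) 1)
    have : inversionConst (2 * (m + 1) + 1) * (2 / (((2 * (m + 1) + 1 : ℕ) : ℝ) * v) *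
        (planeWaveConst m / 2 ^ (2 * m + 1)) *
          -(((2 * (m + 1) + 1 : ℕ) : ℝ) * (((2 * (m + 1) + 1 : ℕ) : ℝ) - 2) * v)) =
        -(inversionConst (2 * (m + 1) + 1) * (planeWaveConst m * (2 * m + 1) / 2 ^ (2 * m))) := by
      have h1 : v ≠ 0 := right_ne_zero_of_mul hσ
      have h2 : (((2 * (m + 1) + 1 : ℕ) : ℝ)) ≠ 0 := left_ne_zero_of_mul hσ
      have h3 : (((2 * (m + 1) + 1 : ℕ) : ℝ)) - 2 = 2 * m + 1 := by
        push_cast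
        ring
      rw [h3, pow_succ]
      field_simp
    rw [mul_assoc (inversionConst _), this, hconst, neg_neg, one_smul]
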